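/- Let $0<d^-\leqslant d^+<\infty$ and let $p$ be fixed with $\max\{1,1/d^-\}<p\leqslant\infty$. There exist $\delta>0$ and $C>0$, depending only on $d^-$, $d^+$ and $p$, such that the following holds. Let $(d_j)_{j\geqslant 1}$ be real numbers with $d^-\leqslant d_j\leqslant d^+$ for all $j\geqslant 1$, and let $(\hat f(j))_{j\geqslant 1}$ be complex numbers. Define $p_n$ and $M_n$ for $n\geqslant 0$ by the generating functions $$ \sum_{n=0}^\infty p_nz^n=\exp\Bigl\{\sum_{j=1}^\infty\frac{d_j}{j}z^j\Bigr\},\qquad \sum_{n=0}^\infty M_nz^n=\exp\Bigl\{\sum_{j=1}^\infty\frac{d_j\hat f(j)}{j}z^j\Bigr\}, $$ put $L_N(z)=\sum_{j=1}^N d_j\frac{\hat f(j)-1}{j}z^j$, and let $$ \rho=\rho(p)=\Bigl(\sum_{j=1}^\infty\frac{|\hat f(j)-1|^p}{j}\Bigr)^{1/p}\ \text{ if } p<\infty,\qquad \rho(\infty)=\sup_{j\geqslant 1}|\hat f(j)-1|. $$ If $\rho\leqslant\delta$, then for every $N\geqslant 0$ $$ \frac{M_N}{p_N}=\exp\{L_N(1)\}\left(1+\sum_{j=1}^N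 d_j\,\frac{\hat f(j)-1}{j}\left(\frac{p_{N-j}}{p_N}-1\right)+R_N\right) \qquad\text{with}\quad |R_N|\leqslant C\rho^2 . $$ -/

import Mathlib

open Finset
open scoped ENNReal

namespace VoronoiMean

noncomputable section

/-- The formal power series `∑_{j ≥ 1} (a_j / j) z ^ j`. -/
def logSeries {K : Type*} [Field K] (a : ℕ → K) : PowerSeries K :=
  PowerSeries.mk fun j => if j = 0 then 0 else a j / (j : K)

/-- The series has constant term zero, so it may be substituted into the exponential series. -/
theorem hasSubst_logSeries {K : Type*} [Field K] (a : ℕ → K) :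
    PowerSeries.HasSubst (logSeries a) :=
  PowerSeries.HasSubst.of_constantCoeff_zero' (by
    rw [← PowerSeries.coeff_zero_eq_constantCoeff_apply]
    simp [logSeries])

/-- The coefficient `[z ^ n] exp (∑_{j ≥ 1} (a_j / j) z ^ j)`. -/
def expCoeff {K : Type*} [Field K] [CharZero K] (a : ℕ → K) (n : ℕ) : K :=
  PowerSeries.coeff n ((PowerSeries.exp K).subst (logSeries a))

/-- `p_n = [z ^ n] exp (∑_{j ≥ 1} (d_j / j) z ^ j)`. -/
def pCoeff (d : ℕ → ℝ) (n : ℕ) : ℝ :=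
  expCoeff d n

/-- `M_n = [z ^ n] exp (∑_{j ≥ 1} (d_j f̂(j) / j) z ^ j)`. -/
def mCoeff (d : ℕ → ℝ) (f : ℕ → ℂ) (n : ℕ) : ℂ :=
  expCoeff (fun j => (d j : ℂ) * f j) n

/-- `L_n(z) = ∑_{j=1}^n d_j ((f̂(j) - 1) / j) z ^ j`. -/
def lPoly (d : ℕ → ℝ) (f : ℕ → ℂ) (n : ℕ) (z : ℂ) : ℂ :=
  ∑ j ∈ Icc 1 n, (d j : ℂ) * ((f j - 1) / (j : ℂ)) * z ^ j

/-- `ρ(p) = (∑_{j ≥ 1} |f̂(j) - 1| ^ p / j) ^ (1 / p)` for finite `p`, and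
`ρ(∞) = sup_{j ≥ 1} |f̂(j) - 1|`; the value is `∞` if the series diverges or the supremum is
infinite. The summation index is shifted by one. -/
def rho (f : ℕ → ℂ) (p : ℝ≥0∞) : ℝ≥0∞ :=
  if p = ∞ then ⨆ j : ℕ, ‖f (j + 1) - 1‖ₑ
  else (∑' j : ℕ, ‖f (j + 1) - 1‖ₑ ^ p.toReal / ((j + 1 : ℕ) : ℝ≥0∞)) ^ (1 / p.toReal)

end

end VoronoiMean

namespace VoronoiMean

/-! ### The coefficient recurrence, products and the entire case. -/

section Recurrence

variable {K : Type*} [Field K] [CharZero K]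

/-! Write `g j = f j - 1`, cut off beyond `N` (which does not affect `M_N`), and `e j = d j * g j`,
`L = ∑ e j / j`. Let `A w` be the `N`-th coefficient belonging to `d + w e`. The function `Φ w = A w
/ p_N * exp (-w L)` is entire, `Φ 0 = 1`, `Φ 1` is the normalised ratio `M_N / p_N`, and `deriv Φ 0`
is the linear term of the expansion. If `‖Φ‖ ≤ 2` on a disc of radius `W = δ / ρ`, Cauchy's
estimates bound the rest of the Taylor series at `1` by `O(1 / W ^ 2) = O(ρ ^ 2)`
(`norm_sub_sub_deriv_le`, `exists_norm_remainder_le`). Replacing `g` by `w g` only scales `ρ`, so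
everything reduces to one upper bound of the right order, `‖M_n‖ ≤ 2 p_n ‖T_n‖` with `T_n = exp
(∑_{j ≤ n} e j / j)`, for small `ρ` (`exists_norm_expCoeff_le`).

That bound is a contraction argument. Let `Y` be the supremum over `n` of the relative error of `p_n
T_n` as an approximation to `M_n`. The recurrence `n M_n = ∑_{i < n} (d + e)(n - i) M_i` alone
averages earlier errors with total weight `1` and gains nothing. The gain comes from the generating
function: at `r = exp (-K / (n + 1))` it equals `P(r) exp (∑ e j / j * r ^ j)`, with `P` the
generating function of the `p_i`, and is close to `P(r) T_n`, so the Abel mean of the errors `M_i -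
p_i T_i` is small. Subtracting `a` times this mean removes a fixed proportion of the weight, and `K`
is chosen so large that the terms beyond `n` give back at most half of it. Hence `Y ≤ (1 - κ) Y +
O(ρ) (1 + Y)` (`norm_sub_le_of_recurrence`), and `Y ≤ 1` for small `ρ`.

The inputs are the regular growth of `p_n`, with exponents between `a - 1` and `b - 1`, the slow
variation of `T_n`, and a bound for `∑ ‖e (n - i)‖ p_i`. The last is a Hölder-type estimate against
the singular weights `p_i`, and it is where `p > 1 / d⁻` is used. -/

theorem expCoeff_zero (a : ℕ → K) : expCoeff a 0 = 1 := by
  have h := PowerSeries.constantCoeff_subst_eq_zero (R := K)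
    (S := K) (a := logSeries a) (by
      change PowerSeries.constantCoeff (logSeries a) = 0
      rw [← PowerSeries.coeff_zero_eq_constantCoeff_apply]; simp [logSeries])
    (PowerSeries.exp K - 1) (by simp)
  have h2 : (PowerSeries.exp K).subst (logSeries a)
      = (PowerSeries.exp K - 1).subst (logSeries a) + 1 := by
    have : PowerSeries.exp K = (PowerSeries.exp K - 1) + (PowerSeries.C (1 : K)) := by simp
    conv_lhs => rw [this, PowerSeries.subst_add (hasSubst_logSeries a)]
    rw [← PowerSeries.coe_substAlgHom (hasSubst_logSeries a)]
    simp
  unfold expCoeff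
  rw [h2]
  simp only [map_add, PowerSeries.coeff_zero_eq_constantCoeff_apply]
  rw [show PowerSeries.constantCoeff ((PowerSeries.exp K - 1).subst (logSeries a)) = 0 from h]
  simp

theorem coeff_derivative_logSeries (a : ℕ → K) (n : ℕ) :
    PowerSeries.coeff n (PowerSeries.derivative K (logSeries a)) = a (n + 1) := by
  rw [PowerSeries.coeff_derivative]
  have : ((n : K) + 1) ≠ 0 := by exact_mod_cast Nat.succ_ne_zero n
  simp [logSeries]
  field_simp

theorem expCoeff_succ (a : ℕ → K) (n : ℕ) :
    ((n : K) + 1) * expCoeff a (n + 1) = ∑ i ∈ range (n + 1), a (i + 1) * expCoeff a (n - i) := by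
  have h := congrArg (PowerSeries.coeff n)
    (PowerSeries.derivative_subst (f := PowerSeries.exp K) (hasSubst_logSeries a))
  rw [PowerSeries.coeff_derivative, PowerSeries.derivative_exp, mul_comm
    ((PowerSeries.exp K).subst (logSeries a)), PowerSeries.coeff_mul,
    Finset.Nat.sum_antidiagonal_eq_sum_range_succ_mk] at h
  rw [mul_comm, expCoeff, h]
  refine sum_congr rfl fun i _ => ?_
  rw [coeff_derivative_logSeries]
  rfl

theorem mul_expCoeff (a : ℕ → K) (n : ℕ) :
    (n : K) * expCoeff a n = ∑ i ∈ range n, a (n - i) * expCoeff a i := by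
  cases n with
  | zero => simp
  | succ n =>
    rw [Nat.cast_succ, expCoeff_succ, ← sum_range_reflect]
    refine sum_congr rfl fun i hi => ?_
    have := mem_range.1 hi
    congr 2 <;> omega

/-- The recurrence determines the coefficients. -/
theorem eq_expCoeff_of_succ (a c : ℕ → K) (h0 : c 0 = 1)
    (h : ∀ n : ℕ, ((n : K) + 1) * c (n + 1) = ∑ i ∈ range (n + 1), a (i + 1) * c (n - i)) (n : ℕ) :
    c n = expCoeff a n := by
  induction n using Nat.strong_induction_on with
  | _ n ih =>
    cases n with
    | zero => rw [h0, expCoeff_zero]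
    | succ n =>
      have hn : ((n : K) + 1) ≠ 0 := by exact_mod_cast Nat.succ_ne_zero n
      apply mul_left_cancel₀ hn
      rw [h, expCoeff_succ]
      refine sum_congr rfl fun i _ => ?_
      rw [ih (n - i) (by omega)]

theorem expCoeff_congr {a b : ℕ → K} {n : ℕ} (h : ∀ j, 1 ≤ j → j ≤ n → a j = b j) :
    expCoeff a n = expCoeff b n := by
  induction n using Nat.strong_induction_on with
  | _ n ih =>
    cases n with
    | zero => rw [expCoeff_zero, expCoeff_zero]
    | succ n =>
      have hn : ((n : K) + 1) ≠ 0 := by exact_mod_cast Nat.succ_ne_zero n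
      apply mul_left_cancel₀ hn
      rw [expCoeff_succ, expCoeff_succ]
      refine sum_congr rfl fun i hi => ?_
      have := mem_range.1 hi
      rw [ih (n - i) (by omega) fun j h1 h2 => h j h1 (by omega), h (i + 1) (by omega) (by omega)]

/-- The product of the two exponentials solves the differential equation of the exponential of the
sum, so its coefficients satisfy the recurrence that determines them. -/
theorem expCoeff_add (a b : ℕ → K) (n : ℕ) :
    expCoeff (fun j => a j + b j) n
      = ∑ i ∈ range (n + 1), expCoeff a i * expCoeff b (n - i) := by
  set A := (PowerSeries.exp K).subst (logSeries a) with hA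
  set B := (PowerSeries.exp K).subst (logSeries b) with hB
  have hd : PowerSeries.derivative K (A * B)
      = PowerSeries.derivative K (logSeries fun j => a j + b j) * (A * B) := by
    have hl : logSeries (fun j => a j + b j) = logSeries a + logSeries b := by
      ext j
      by_cases hj : j = 0 <;> simp [logSeries, hj, add_div]
    rw [Derivation.leibniz, hA, hB, PowerSeries.derivative_subst (hasSubst_logSeries a),
      PowerSeries.derivative_subst (hasSubst_logSeries b), PowerSeries.derivative_exp, hl, map_add]
    simp only [smul_eq_mul]
    ring
  have key := eq_expCoeff_of_succ (fun j => a j + b j) (fun n => PowerSeries.coeff n (A * B))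
    (by
      have h1 : PowerSeries.constantCoeff A = 1 := by
        rw [← PowerSeries.coeff_zero_eq_constantCoeff_apply]; exact expCoeff_zero a
      have h2 : PowerSeries.constantCoeff B = 1 := by
        rw [← PowerSeries.coeff_zero_eq_constantCoeff_apply]; exact expCoeff_zero b
      simp [h1, h2])
    (fun n => by
      have h := congrArg (PowerSeries.coeff n) hd
      rw [PowerSeries.coeff_derivative, PowerSeries.coeff_mul _ _ (A * B),
        Finset.Nat.sum_antidiagonal_eq_sum_range_succ_mk] at h
      rw [mul_comm, h]
      exact sum_congr rfl fun i _ => by rw [coeff_derivative_logSeries]) n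
  rw [← key, PowerSeries.coeff_mul, Finset.Nat.sum_antidiagonal_eq_sum_range_succ_mk]
  rfl

end Recurrence

theorem expCoeff_ofReal (d : ℕ → ℝ) (n : ℕ) :
    expCoeff (fun j => (d j : ℂ)) n = (pCoeff d n : ℂ) := by
  refine (eq_expCoeff_of_succ _ (fun n => (pCoeff d n : ℂ)) ?_ fun n => ?_) n |>.symm
  · simp [pCoeff, expCoeff_zero]
  · have := expCoeff_succ d n
    simp only [pCoeff]
    exact_mod_cast congrArg (fun x : ℝ => (x : ℂ)) this

/-- If `a` has finite support, the coefficients `expCoeff a` expand an entire function. -/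
theorem hasSum_expCoeff {a : ℕ → ℂ} {N : ℕ} (ha : ∀ j, N < j → a j = 0) (z : ℂ) :
    HasSum (fun n => expCoeff a n * z ^ n)
      (Complex.exp (∑ j ∈ Icc 1 N, a j / (j : ℂ) * z ^ j)) := by
  set L : ℂ → ℂ := fun z => ∑ j ∈ Icc 1 N, a j / (j : ℂ) * z ^ j with hL
  set D : ℂ → ℂ := fun z => ∑ j ∈ range N, a (j + 1) * z ^ j with hD
  have hLd (z : ℂ) : HasDerivAt L (D z) z := by
    have h1 : HasDerivAt L (∑ j ∈ Icc 1 N, a j / (j : ℂ) * ((j : ℂ) * z ^ (j - 1))) z :=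
      HasDerivAt.fun_sum fun j _ => (hasDerivAt_pow j z).const_mul _
    convert h1 using 1
    have h2 := Finset.sum_Ico_add' (fun j => a j * z ^ (j - 1)) 0 N 1
    simp only [Nat.add_sub_cancel] at h2
    simp only [hD, range_eq_Ico]
    rw [h2]
    refine sum_congr (by ext; simp) fun j hj => ?_
    have : (j : ℂ) ≠ 0 := by
      have := (mem_Icc.1 hj).1
      exact_mod_cast (by omega : j ≠ 0)
    field_simp
  have hφd (z : ℂ) : HasDerivAt (fun z => Complex.exp (L z)) (Complex.exp (L z) * D z) z :=
    (hLd z).cexp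
  have hφ : Differentiable ℂ (fun z => Complex.exp (L z)) := fun z => (hφd z).differentiableAt
  have hDc : ContDiff ℂ ⊤ D := ContDiff.sum fun j _ => contDiff_const.mul (contDiff_id.pow j)
  have hderiv : deriv (fun z => Complex.exp (L z)) = D * fun z => Complex.exp (L z) := by
    ext z
    rw [(hφd z).deriv, mul_comm, Pi.mul_apply]
  have hDi (i : ℕ) : iteratedDeriv i D 0 = i.factorial * a (i + 1) := by
    rw [hD, iteratedDeriv_fun_sum fun j _ =>
      (contDiffAt_const.mul (contDiffAt_id.pow j) :
        ContDiffAt ℂ _ (fun z : ℂ => a (j + 1) * z ^ j) 0)]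
    have h (j : ℕ) : iteratedDeriv i (fun z : ℂ => a (j + 1) * z ^ j) 0
        = a (j + 1) * if i = j then (j.factorial : ℂ) else 0 := by
      rw [iteratedDeriv_const_mul_field (a (j + 1)) fun z : ℂ => z ^ j, iteratedDeriv_fun_pow_zero]
      split_ifs <;> simp
    simp only [h, mul_ite, mul_zero, sum_ite_eq, mem_range]
    split_ifs with h
    · ring
    · rw [ha (i + 1) (by omega)]; simp
  have hc := eq_expCoeff_of_succ a
    (fun n => ((n.factorial : ℂ))⁻¹ * iteratedDeriv n (fun z => Complex.exp (L z)) 0)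
    (by
      have : L 0 = 0 := by
        refine sum_eq_zero fun j hj => ?_
        have := (mem_Icc.1 hj).1
        simp [show j ≠ 0 by omega]
      simp [this])
    -- Leibniz' rule for `φ' = D φ` at `0`, divided by `n!`, is the recurrence.
    (fun n => by
      rw [iteratedDeriv_succ', hderiv, iteratedDeriv_mul (hDc.contDiffAt.of_le le_top)
        (hφ.contDiff.contDiffAt), Nat.factorial_succ, Nat.cast_mul, mul_inv, Nat.cast_succ]
      have hn : ((n : ℂ) + 1) ≠ 0 := by exact_mod_cast Nat.succ_ne_zero n
      rw [← mul_assoc, mul_inv_cancel_left₀ hn, mul_sum]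
      refine sum_congr rfl fun i hi => ?_
      have hi' : i ≤ n := by have := mem_range.1 hi; omega
      rw [hDi, Nat.cast_choose ℂ hi']
      have h1 := Nat.factorial_ne_zero n
      have h2 := Nat.factorial_ne_zero i
      have h3 := Nat.factorial_ne_zero (n - i)
      field_simp)
  have := Complex.hasSum_taylorSeries_of_entire hφ 0 z
  simp_rw [← hc]
  refine this.congr_fun fun n => ?_
  simp only [sub_zero, smul_eq_mul]
  ring


/-- Bernoulli's inequality bounds each `(m + 1) ^ (-c)` by an increment of `m ^ (1 - c) / (1 - c)`,
and the sum telescopes. The factor `2` comes from `n + 1 ≤ 2 n`. -/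
theorem sum_div_rpow_le {c : ℝ} (hc0 : 0 ≤ c) (hc : c < 1) (n : ℕ) :
    ∑ i ∈ range n, (((n : ℝ) + 1) / ((i : ℝ) + 1)) ^ c ≤ 2 / (1 - c) * n := by
  have hc1 : 0 < 1 - c := by linarith
  have key (m : ℕ) : ∑ i ∈ range m, ((i : ℝ) + 1) ^ (-c) ≤ (m : ℝ) ^ (1 - c) / (1 - c) := by
    induction m with
    | zero => simp [Real.zero_rpow hc1.ne']
    | succ m ih =>
      rw [sum_range_succ]
      have hm : (0 : ℝ) < (m : ℝ) + 1 := by positivity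
      have h1 : (m : ℝ) ^ (1 - c) ≤ ((m : ℝ) + 1) ^ (1 - c) * (1 - (1 - c) / ((m : ℝ) + 1)) := by
        have h2 : (1 + -1 / ((m : ℝ) + 1)) ^ (1 - c) ≤ 1 + (1 - c) * (-1 / ((m : ℝ) + 1)) := by
          refine rpow_one_add_le_one_add_mul_self ?_ hc1.le (by linarith)
          rw [neg_div, neg_le_neg_iff, div_le_one hm]
          linarith [Nat.cast_nonneg (α := ℝ) m]
        have h3 : (m : ℝ) = ((m : ℝ) + 1) * (1 + -1 / ((m : ℝ) + 1)) := by field_simp; ring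
        have h4 : (0 : ℝ) ≤ 1 + -1 / ((m : ℝ) + 1) := by
          have : 1 + -1 / ((m : ℝ) + 1) = m / (m + 1) := by field_simp; ring
          rw [this]; positivity
        calc (m : ℝ) ^ (1 - c) = (((m : ℝ) + 1) * (1 + -1 / ((m : ℝ) + 1))) ^ (1 - c) := by
              rw [← h3]
          _ = ((m : ℝ) + 1) ^ (1 - c) * (1 + -1 / ((m : ℝ) + 1)) ^ (1 - c) :=
              Real.mul_rpow hm.le h4
          _ ≤ ((m : ℝ) + 1) ^ (1 - c) * (1 + (1 - c) * (-1 / ((m : ℝ) + 1))) := by gcongr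
          _ = _ := by ring
      have h5 : ((m : ℝ) + 1) ^ (1 - c) / ((m : ℝ) + 1) = ((m : ℝ) + 1) ^ (-c) := by
        rw [← Real.rpow_sub_one hm.ne']; congr 1; ring
      have h6 : (m : ℝ) ^ (1 - c) ≤ ((m : ℝ) + 1) ^ (1 - c) - (1 - c) * ((m : ℝ) + 1) ^ (-c) := by
        rw [← h5]; refine h1.trans (le_of_eq ?_); ring
      push_cast
      rw [le_div_iff₀ hc1] at ih ⊢
      nlinarith
  rcases Nat.eq_zero_or_pos n with rfl | hn
  · simp
  have hn0 : (0 : ℝ) < n := by exact_mod_cast hn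
  have hn1 : (1 : ℝ) ≤ n := by exact_mod_cast hn
  have h1 : ∑ i ∈ range n, (((n : ℝ) + 1) / ((i : ℝ) + 1)) ^ c
      = ((n : ℝ) + 1) ^ c * ∑ i ∈ range n, ((i : ℝ) + 1) ^ (-c) := by
    rw [mul_sum]
    refine sum_congr rfl fun i _ => ?_
    rw [Real.div_rpow (by positivity) (by positivity), Real.rpow_neg (by positivity)]
    rfl
  rw [h1]
  calc ((n : ℝ) + 1) ^ c * ∑ i ∈ range n, ((i : ℝ) + 1) ^ (-c)
      ≤ (2 * n : ℝ) ^ c * ((n : ℝ) ^ (1 - c) / (1 - c)) := by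
        gcongr
        · linarith
        · exact key n
    _ = 2 ^ c * ((n : ℝ) ^ c * (n : ℝ) ^ (1 - c)) / (1 - c) := by
        rw [Real.mul_rpow (by norm_num) hn0.le]; ring
    _ = 2 ^ c * n / (1 - c) := by
        rw [← Real.rpow_add hn0]; simp
    _ ≤ 2 ^ (1 : ℝ) * n / (1 - c) := by
        gcongr
        norm_num
    _ = _ := by rw [Real.rpow_one]; ring

/-! ### Growth of the unperturbed coefficients. -/

section Bounds

variable {a b : ℝ} {d : ℕ → ℝ}

theorem mul_pCoeff (d : ℕ → ℝ) (n : ℕ) :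
    (n : ℝ) * pCoeff d n = ∑ i ∈ range n, d (n - i) * pCoeff d i :=
  mul_expCoeff d n

theorem pCoeff_zero (d : ℕ → ℝ) : pCoeff d 0 = 1 := expCoeff_zero d

theorem pCoeff_pos (ha : 0 < a) (hd : ∀ j, 1 ≤ j → a ≤ d j ∧ d j ≤ b) (n : ℕ) :
    0 < pCoeff d n := by
  induction n using Nat.strong_induction_on with
  | _ n ih =>
    rcases Nat.eq_zero_or_pos n with rfl | hn
    · rw [pCoeff_zero]; exact one_pos
    · have h : 0 < (n : ℝ) * pCoeff d n := by
        rw [mul_pCoeff]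
        refine sum_pos (fun i hi => ?_) ⟨0, mem_range.2 hn⟩
        have := mem_range.1 hi
        exact mul_pos (ha.trans_le (hd _ (by omega)).1) (ih i this)
      exact pos_of_mul_pos_right h (Nat.cast_nonneg n)

theorem le_mul_pCoeff (ha : 0 < a) (hd : ∀ j, 1 ≤ j → a ≤ d j ∧ d j ≤ b) (n : ℕ) :
    a * ∑ i ∈ range n, pCoeff d i ≤ n * pCoeff d n := by
  rw [mul_pCoeff, mul_sum]
  refine sum_le_sum fun i hi => ?_
  have := mem_range.1 hi
  exact mul_le_mul_of_nonneg_right (hd _ (by omega)).1 (pCoeff_pos ha hd i).le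

theorem mul_pCoeff_le (ha : 0 < a) (hd : ∀ j, 1 ≤ j → a ≤ d j ∧ d j ≤ b) (n : ℕ) :
    n * pCoeff d n ≤ b * ∑ i ∈ range n, pCoeff d i := by
  rw [mul_pCoeff, mul_sum]
  refine sum_le_sum fun i hi => ?_
  have := mem_range.1 hi
  exact mul_le_mul_of_nonneg_right (hd _ (by omega)).2 (pCoeff_pos ha hd i).le

/-- The partial sums of `pCoeff d`. -/
noncomputable def pSum (d : ℕ → ℝ) (n : ℕ) : ℝ := ∑ i ∈ range (n + 1), pCoeff d i

theorem pSum_pos (ha : 0 < a) (hd : ∀ j, 1 ≤ j → a ≤ d j ∧ d j ≤ b) (n : ℕ) : 0 < pSum d n :=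
  sum_pos (fun i _ => pCoeff_pos ha hd i) ⟨0, by simp⟩

theorem mul_pSum_le (ha : 0 < a) (ha1 : a ≤ 1) (hd : ∀ j, 1 ≤ j → a ≤ d j ∧ d j ≤ b) (n : ℕ) :
    a * pSum d n ≤ (n + 1) * pCoeff d n := by
  have h := le_mul_pCoeff ha hd n
  have := pCoeff_pos ha hd n
  rw [pSum, sum_range_succ]
  nlinarith

theorem pCoeff_le_pSum (ha : 0 < a) (hb : 1 ≤ b) (hd : ∀ j, 1 ≤ j → a ≤ d j ∧ d j ≤ b) (n : ℕ) :
    (n + 1) * pCoeff d n ≤ 2 * b * pSum d n := by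
  have h := mul_pCoeff_le ha hd n
  have hp := pCoeff_pos ha hd n
  have h2 : 0 ≤ ∑ i ∈ range n, pCoeff d i := sum_nonneg fun i _ => (pCoeff_pos ha hd i).le
  rw [pSum, sum_range_succ]
  nlinarith [mul_nonneg (by linarith : (0 : ℝ) ≤ b) h2, mul_le_mul_of_nonneg_right hb hp.le]

/-- Each step multiplies the partial sum by at least `1 + a / (n + 1)`, which dominates `(1 + 1 / (n
+ 1)) ^ a` by Bernoulli because `a ≤ 1`. The companion bound uses `1 ≤ b` in the same way. -/
theorem pSum_mul_rpow_le (ha : 0 < a) (ha1 : a ≤ 1) (hd : ∀ j, 1 ≤ j → a ≤ d j ∧ d j ≤ b)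
    {i n : ℕ} (hin : i ≤ n) :
    pSum d i * (((n : ℝ) + 1) / ((i : ℝ) + 1)) ^ a ≤ pSum d n := by
  induction n, hin using Nat.le_induction with
  | base => rw [div_self (by positivity), Real.one_rpow, mul_one]
  | succ n _ ih =>
    have h1 := le_mul_pCoeff ha hd (n + 1)
    have h2 : pSum d (n + 1) = pSum d n + pCoeff d (n + 1) := by rw [pSum, sum_range_succ]; rfl
    have hn : (0 : ℝ) < (n : ℝ) + 1 := by positivity
    have hn' : 0 ≤ 1 / ((n : ℝ) + 1) := by positivity
    have h3 : (1 + 1 / ((n : ℝ) + 1)) ^ a ≤ 1 + a * (1 / ((n : ℝ) + 1)) :=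
      rpow_one_add_le_one_add_mul_self (by linarith) ha.le ha1
    have h4 : (((n + 1 : ℕ) : ℝ) + 1) / ((i : ℝ) + 1)
        = ((n : ℝ) + 1) / ((i : ℝ) + 1) * (1 + 1 / ((n : ℝ) + 1)) := by push_cast; field_simp
    rw [h4, Real.mul_rpow (by positivity) (by positivity), ← mul_assoc]
    calc _ ≤ pSum d n * (1 + a * (1 / ((n : ℝ) + 1))) :=
          mul_le_mul ih h3 (by positivity) (pSum_pos ha hd n).le
      _ = pSum d n + a * pSum d n / ((n : ℝ) + 1) := by ring
      _ ≤ pSum d n + pCoeff d (n + 1) := by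
          gcongr
          rw [div_le_iff₀ hn, mul_comm (pCoeff d (n + 1))]
          push_cast at h1
          exact h1
      _ = _ := h2.symm

theorem pSum_le_mul_rpow (ha : 0 < a) (hb : 1 ≤ b) (hd : ∀ j, 1 ≤ j → a ≤ d j ∧ d j ≤ b)
    {i n : ℕ} (hin : i ≤ n) :
    pSum d n ≤ pSum d i * (((n : ℝ) + 1) / ((i : ℝ) + 1)) ^ b := by
  induction n, hin using Nat.le_induction with
  | base => rw [div_self (by positivity), Real.one_rpow, mul_one]
  | succ n _ ih =>
    have h1 := mul_pCoeff_le ha hd (n + 1)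
    have h2 : pSum d (n + 1) = pSum d n + pCoeff d (n + 1) := by rw [pSum, sum_range_succ]; rfl
    have hn : (0 : ℝ) < (n : ℝ) + 1 := by positivity
    have hn' : 0 ≤ 1 / ((n : ℝ) + 1) := by positivity
    have h3 : 1 + b * (1 / ((n : ℝ) + 1)) ≤ (1 + 1 / ((n : ℝ) + 1)) ^ b :=
      one_add_mul_self_le_rpow_one_add (by linarith) hb
    have h4 : (((n + 1 : ℕ) : ℝ) + 1) / ((i : ℝ) + 1)
        = ((n : ℝ) + 1) / ((i : ℝ) + 1) * (1 + 1 / ((n : ℝ) + 1)) := by push_cast; field_simp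
    rw [h4, Real.mul_rpow (by positivity) (by positivity), ← mul_assoc]
    calc pSum d (n + 1) = pSum d n + pCoeff d (n + 1) := h2
      _ ≤ pSum d n + b * pSum d n / ((n : ℝ) + 1) := by
          gcongr
          rw [le_div_iff₀ hn, mul_comm (pCoeff d (n + 1))]
          push_cast at h1
          exact h1
      _ = pSum d n * (1 + b * (1 / ((n : ℝ) + 1))) := by ring
      _ ≤ _ := mul_le_mul ih h3 (by positivity)
          (mul_nonneg (pSum_pos ha hd i).le (by positivity))

/-- Up to constants `p_n` is its partial sum divided by `n + 1`, so growth of the partial sums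
transfers to the coefficients with the exponent lowered by one. -/
theorem pCoeff_le_of_le (ha : 0 < a) (ha1 : a ≤ 1) (hb : 1 ≤ b)
    (hd : ∀ j, 1 ≤ j → a ≤ d j ∧ d j ≤ b) {i n : ℕ} (hin : i ≤ n) :
    pCoeff d i ≤ 2 * b / a * pCoeff d n * (((n : ℝ) + 1) / ((i : ℝ) + 1)) ^ (1 - a) := by
  have h1 := pCoeff_le_pSum ha hb hd i
  have h2 := pSum_mul_rpow_le ha ha1 hd hin
  have h3 := mul_pSum_le ha ha1 hd n
  set u : ℝ := ((n : ℝ) + 1) / ((i : ℝ) + 1) with hu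
  have hu0 : 0 < u := by positivity
  have hi : (0 : ℝ) < (i : ℝ) + 1 := by positivity
  rw [Real.rpow_sub hu0, Real.rpow_one]
  have hua : 0 < u ^ a := by positivity
  rw [mul_div_assoc', le_div_iff₀ hua]
  have h4 : u * ((i : ℝ) + 1) = n + 1 := by rw [hu]; field_simp
  have h5 : ((i : ℝ) + 1) * (pCoeff d i * u ^ a) ≤ 2 * b * pSum d n :=
    calc ((i : ℝ) + 1) * (pCoeff d i * u ^ a) = ((i + 1) * pCoeff d i) * u ^ a := by ring
      _ ≤ 2 * b * pSum d i * u ^ a := by gcongr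
      _ = 2 * b * (pSum d i * u ^ a) := by ring
      _ ≤ _ := by gcongr
  have h6 : pSum d n ≤ (n + 1) * pCoeff d n / a := by
    rw [le_div_iff₀ ha]; linarith
  refine le_of_mul_le_mul_left (h5.trans ?_) hi
  calc 2 * b * pSum d n ≤ 2 * b * ((n + 1) * pCoeff d n / a) := by gcongr
    _ = _ := by rw [← h4]; ring

theorem pCoeff_le_of_ge (ha : 0 < a) (ha1 : a ≤ 1) (hb : 1 ≤ b)
    (hd : ∀ j, 1 ≤ j → a ≤ d j ∧ d j ≤ b) {i n : ℕ} (hin : n ≤ i) :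
    pCoeff d i ≤ 2 * b / a * pCoeff d n * (((i : ℝ) + 1) / ((n : ℝ) + 1)) ^ (b - 1) := by
  have h1 := pCoeff_le_pSum ha hb hd i
  have h2 := pSum_le_mul_rpow ha hb hd hin
  have h3 := mul_pSum_le ha ha1 hd n
  set u : ℝ := ((i : ℝ) + 1) / ((n : ℝ) + 1) with hu
  have hu0 : 0 < u := by positivity
  have hi : (0 : ℝ) < (i : ℝ) + 1 := by positivity
  rw [Real.rpow_sub_one hu0.ne']
  have h4 : u * ((n : ℝ) + 1) = i + 1 := by rw [hu]; field_simp
  have h6 : pSum d n ≤ (n + 1) * pCoeff d n / a := by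
    rw [le_div_iff₀ ha]; linarith
  refine le_of_mul_le_mul_left (h1.trans ?_) hi
  calc 2 * b * pSum d i ≤ 2 * b * ((n + 1) * pCoeff d n / a * u ^ b) := by
        gcongr
        exact h2.trans (by gcongr)
    _ = _ := by rw [← h4]; field_simp

/-! ### Abel weights: mass before and beyond `n`. -/

/-- The exponent `K` for which the Abel weights `exp (-K i / (n + 1))` put at most half as much mass
beyond `n` as before `n`. -/
noncomputable def abelExp (a b : ℝ) : ℝ := b + 8 * b ^ 2 / a

/-- The radius `exp (-K / (n + 1))`. -/
noncomputable def abelRadius (a b : ℝ) (n : ℕ) : ℝ := Real.exp (-(abelExp a b / ((n : ℝ) + 1)))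

theorem abelRadius_pos (a b : ℝ) (n : ℕ) : 0 < abelRadius a b n := Real.exp_pos _

theorem abelExp_pos (ha : 0 < a) (hb : 1 ≤ b) : 0 < abelExp a b := by
  unfold abelExp; positivity

theorem abelRadius_lt_one (ha : 0 < a) (hb : 1 ≤ b) (n : ℕ) : abelRadius a b n < 1 := by
  have := abelExp_pos ha hb
  rw [abelRadius, Real.exp_lt_one_iff, neg_lt_zero]
  positivity

theorem abelRadius_pow (a b : ℝ) (n i : ℕ) :
    abelRadius a b n ^ i = Real.exp (-(abelExp a b * i / ((n : ℝ) + 1))) := by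
  rw [abelRadius, ← Real.exp_nat_mul]
  congr 1; ring

theorem exp_neg_div_one_sub_le {x : ℝ} (hx : 0 < x) :
    Real.exp (-x) / (1 - Real.exp (-x)) ≤ 1 / x := by
  have h1 : Real.exp (-x) < 1 := by rw [Real.exp_lt_one_iff]; linarith
  rw [div_le_div_iff₀ (by linarith) hx]
  have h2 := mul_le_mul_of_nonneg_right (Real.add_one_le_exp x) (Real.exp_pos (-x)).le
  rw [← Real.exp_add] at h2
  simp at h2
  linarith

/-- The least Abel weight occurring is the one at `i = n - 1`. -/
theorem head_ge (ha : 0 < a) (hb : 1 ≤ b) (hd : ∀ j, 1 ≤ j → a ≤ d j ∧ d j ≤ b) {n : ℕ} :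
    Real.exp (-(abelExp a b * ((n : ℝ) - 1) / ((n : ℝ) + 1))) * (n * pCoeff d n / b) ≤
      ∑ i ∈ range n, pCoeff d i * abelRadius a b n ^ i := by
  have hK := abelExp_pos ha hb
  have h1 : n * pCoeff d n / b ≤ ∑ i ∈ range n, pCoeff d i := by
    rw [div_le_iff₀ (by linarith)]
    linarith [mul_pCoeff_le ha hd n]
  calc _ ≤ Real.exp (-(abelExp a b * ((n : ℝ) - 1) / ((n : ℝ) + 1))) * ∑ i ∈ range n, pCoeff d i :=
        by gcongr
    _ ≤ _ := by
        rw [mul_sum]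
        refine sum_le_sum fun i hi => ?_
        rw [mul_comm, abelRadius_pow]
        have : (i : ℝ) ≤ n - 1 := by
          have := mem_range.1 hi
          rw [le_sub_iff_add_le]; exact_mod_cast this
        have hp := (pCoeff_pos ha hd i).le
        gcongr

/-- With `u = (n + l + 1) / (n + 1)`, the growth `u ^ (b - 1)` of the coefficients and the extra
factor `u ^ γ` together are at most `u ^ b ≤ exp (b l / (n + 1))`. The summand `b` of `K` absorbs
this; the summand `8 b ^ 2 / a` leaves a geometric series small against the bound of `head_ge`. -/
theorem tail_le (ha : 0 < a) (ha1 : a ≤ 1) (hb : 1 ≤ b)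
    (hd : ∀ j, 1 ≤ j → a ≤ d j ∧ d j ≤ b) {n : ℕ} (hn : 1 ≤ n) {γ : ℝ} (hγ : γ ≤ 1) :
    Summable (fun l : ℕ => pCoeff d (n + l) * abelRadius a b n ^ (n + l) *
        ((((n + l : ℕ) : ℝ) + 1) / ((n : ℝ) + 1)) ^ γ) ∧
      ∑' l : ℕ, pCoeff d (n + l) * abelRadius a b n ^ (n + l) *
        ((((n + l : ℕ) : ℝ) + 1) / ((n : ℝ) + 1)) ^ γ ≤
      (∑ i ∈ range n, pCoeff d i * abelRadius a b n ^ i) / 2 := by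
  have hK := abelExp_pos ha hb
  have hn0 : (0 : ℝ) < (n : ℝ) + 1 := by positivity
  have hn1 : (1 : ℝ) ≤ n := by exact_mod_cast hn
  have hb0 : 0 < b := by linarith
  have hp := pCoeff_pos ha hd n
  set x : ℝ := (8 * b ^ 2 / a) / ((n : ℝ) + 1) with hx
  have hx0 : 0 < x := by positivity
  set q : ℝ := Real.exp (-x) with hq
  have hq0 : 0 < q := Real.exp_pos _
  have hq1 : q < 1 := by rw [hq, Real.exp_lt_one_iff]; linarith
  set A : ℝ := Real.exp (-(abelExp a b * ((n : ℝ) - 1) / ((n : ℝ) + 1))) with hA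
  have hterm (l : ℕ) : pCoeff d (n + l) * abelRadius a b n ^ (n + l) *
      ((((n + l : ℕ) : ℝ) + 1) / ((n : ℝ) + 1)) ^ γ ≤ (2 * b / a * pCoeff d n * A * q) * q ^ l := by
    have h1 := pCoeff_le_of_ge ha ha1 hb hd (Nat.le_add_right n l)
    set u : ℝ := (((n + l : ℕ) : ℝ) + 1) / ((n : ℝ) + 1) with hu
    have hu' : u = 1 + l / ((n : ℝ) + 1) := by rw [hu]; push_cast; field_simp; ring
    have hu1 : 1 ≤ u := by
      rw [hu']
      have : 0 ≤ l / ((n : ℝ) + 1) := by positivity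
      linarith
    have hu0 : 0 < u := by linarith
    have h2 : u ^ (b - 1) * u ^ γ ≤ Real.exp (b * (l / ((n : ℝ) + 1))) := by
      rw [← Real.rpow_add hu0]
      calc u ^ (b - 1 + γ) ≤ u ^ b := Real.rpow_le_rpow_of_exponent_le hu1 (by linarith)
        _ ≤ (Real.exp (l / ((n : ℝ) + 1))) ^ b := by
            gcongr
            rw [hu', add_comm]
            exact Real.add_one_le_exp _
        _ = _ := by rw [← Real.exp_mul, mul_comm]
    have h3 : abelRadius a b n ^ (n + l) * Real.exp (b * (l / ((n : ℝ) + 1))) ≤ A * q * q ^ l := by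
      rw [abelRadius_pow, hq, hA, ← Real.exp_nat_mul, ← Real.exp_add, ← Real.exp_add,
        ← Real.exp_add, Real.exp_le_exp, hx]
      rw [← sub_nonneg]
      have : -(abelExp a b * ((n : ℝ) - 1) / ((n : ℝ) + 1)) + -(8 * b ^ 2 / a / ((n : ℝ) + 1))
          + l * -(8 * b ^ 2 / a / ((n : ℝ) + 1))
          - (-(abelExp a b * ((n + l : ℕ) : ℝ) / ((n : ℝ) + 1)) + b * (l / ((n : ℝ) + 1)))
          = b / ((n : ℝ) + 1) := by
        unfold abelExp
        push_cast
        field_simp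
        ring
      rw [this]
      positivity
    have hr := abelRadius_pos a b n
    calc _ ≤ (2 * b / a * pCoeff d n * u ^ (b - 1)) * abelRadius a b n ^ (n + l) * u ^ γ := by
          gcongr
      _ = 2 * b / a * pCoeff d n * (abelRadius a b n ^ (n + l) * (u ^ (b - 1) * u ^ γ)) := by ring
      _ ≤ 2 * b / a * pCoeff d n *
          (abelRadius a b n ^ (n + l) * Real.exp (b * (l / ((n : ℝ) + 1)))) := by gcongr
      _ ≤ 2 * b / a * pCoeff d n * (A * q * q ^ l) := by gcongr
      _ = _ := by ring
  have hgs : HasSum (fun l : ℕ => (2 * b / a * pCoeff d n * A * q) * q ^ l)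
      ((2 * b / a * pCoeff d n * A * q) * (1 - q)⁻¹) :=
    (hasSum_geometric_of_lt_one hq0.le hq1).mul_left _
  have hnn (l : ℕ) : 0 ≤ pCoeff d (n + l) * abelRadius a b n ^ (n + l) *
      ((((n + l : ℕ) : ℝ) + 1) / ((n : ℝ) + 1)) ^ γ := by
    have := (pCoeff_pos ha hd (n + l)).le
    have hr := abelRadius_pos a b n
    positivity
  have hs := Summable.of_nonneg_of_le hnn hterm hgs.summable
  refine ⟨hs, ?_⟩
  calc _ ≤ (2 * b / a * pCoeff d n * A * q) * (1 - q)⁻¹ := by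
        rw [← hgs.tsum_eq]; exact hs.tsum_le_tsum hterm hgs.summable
    _ = 2 * b / a * pCoeff d n * A * (q / (1 - q)) := by ring
    _ ≤ 2 * b / a * pCoeff d n * A * (1 / x) := by
        exact mul_le_mul_of_nonneg_left (exp_neg_div_one_sub_le hx0) (by positivity)
    _ = A * ((n + 1) * pCoeff d n / b) / 4 := by rw [hx]; field_simp; ring
    -- Here `1 ≤ n` is needed.
    _ ≤ A * (((n + n) * pCoeff d n) / b) / 4 := by gcongr
    _ = A * (n * pCoeff d n / b) / 2 := by ring
    _ ≤ _ := by gcongr; exact head_ge ha hb hd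

theorem head_le (ha : 0 < a) (hb : 1 ≤ b) (hd : ∀ j, 1 ≤ j → a ≤ d j ∧ d j ≤ b) (n : ℕ) :
    ∑ i ∈ range n, pCoeff d i * abelRadius a b n ^ i ≤ n * pCoeff d n / a := by
  rw [le_div_iff₀ ha, mul_comm]
  refine le_trans ?_ (le_mul_pCoeff ha hd n)
  gcongr with i hi
  exact mul_le_of_le_one_right (pCoeff_pos ha hd i).le
    (pow_le_one₀ (abelRadius_pos a b n).le (abelRadius_lt_one ha hb n).le)

/-- The weights `p_i` contribute the singular exponent `1 - a`, and `1 - a + γ` stays below `1`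
exactly when `γ < a`. -/
theorem sum_pCoeff_mul_rpow_le (ha : 0 < a) (ha1 : a ≤ 1) (hb : 1 ≤ b)
    (hd : ∀ j, 1 ≤ j → a ≤ d j ∧ d j ≤ b) (n : ℕ) {γ : ℝ} (hγ0 : 0 ≤ γ) (hγ : γ < a) :
    ∑ i ∈ range n, pCoeff d i * (((n : ℝ) + 1) / ((i : ℝ) + 1)) ^ γ
      ≤ 4 * b / (a * (a - γ)) * (n * pCoeff d n) := by
  have hp := pCoeff_pos ha hd n
  calc _ ≤ ∑ i ∈ range n, 2 * b / a * pCoeff d n *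
        (((n : ℝ) + 1) / ((i : ℝ) + 1)) ^ (1 - a + γ) := by
        refine sum_le_sum fun i hi => ?_
        rw [Real.rpow_add (by positivity), ← mul_assoc]
        gcongr
        exact pCoeff_le_of_le ha ha1 hb hd (mem_range.1 hi).le
    _ ≤ 2 * b / a * pCoeff d n * (2 / (1 - (1 - a + γ)) * n) := by
        rw [← mul_sum]
        gcongr
        exact sum_div_rpow_le (by linarith) (by linarith) n
    _ = _ := by
        have : a - γ ≠ 0 := by linarith
        rw [show 1 - (1 - a + γ) = a - γ by ring]
        field_simp
        ring

end Bounds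


/-! ### Perturbations that are small in logarithmic mean. -/

/-- A sequence whose terms, divided by `ρ`, have `s`-th powers bounded by `1` up to a remainder of
logarithmic mass at most `1`. -/
def IsLogSmall (s ρ : ℝ) (g : ℕ → ℂ) : Prop :=
  ∃ t h : ℕ → ℝ, (∀ j, 1 ≤ j → ‖g j‖ ≤ ρ * t j ∧ 0 ≤ t j ∧ t j ^ s ≤ 1 + h j ∧ 0 ≤ h j) ∧
    ∀ n, ∑ j ∈ Icc 1 n, h j / j ≤ 1

theorem le_one_add_rpow {t s : ℝ} (ht : 0 ≤ t) (hs : 1 ≤ s) : t ≤ 1 + t ^ s := by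
  rcases le_total t 1 with h | h
  · have := Real.rpow_nonneg ht s
    linarith
  · have := Real.rpow_le_rpow_of_exponent_le h hs
    rw [Real.rpow_one] at this
    linarith

theorem sum_Ioc_inv_le {i n : ℕ} (hin : i ≤ n) :
    ∑ j ∈ Ioc i n, 1 / (j : ℝ) ≤ 2 * Real.log (((n : ℝ) + 1) / ((i : ℝ) + 1)) := by
  induction n, hin using Nat.le_induction with
  | base => rw [div_self (by positivity)]; simp
  | succ n hn ih =>
    rw [sum_Ioc_succ_top (by omega)]
    have h4 : (((n + 1 : ℕ) : ℝ) + 1) / ((i : ℝ) + 1)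
        = ((n : ℝ) + 1) / ((i : ℝ) + 1) * (((n : ℝ) + 2) / ((n : ℝ) + 1)) := by
      push_cast; field_simp; ring
    rw [h4, Real.log_mul (by positivity) (by positivity)]
    have h5 := Real.one_sub_inv_le_log_of_pos
      (show (0 : ℝ) < ((n : ℝ) + 2) / ((n : ℝ) + 1) by positivity)
    have h6 : 1 / (((n + 1 : ℕ) : ℝ)) ≤ 2 * (1 - (((n : ℝ) + 2) / ((n : ℝ) + 1))⁻¹) := by
      have : 2 * (1 - (((n : ℝ) + 2) / ((n : ℝ) + 1))⁻¹) = 2 / ((n : ℝ) + 2) := by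
        field_simp; ring
      rw [this, div_le_div_iff₀ (by positivity) (by positivity)]
      push_cast
      linarith [Nat.cast_nonneg (α := ℝ) n]
    linarith

theorem norm_exp_sub_one_le_exp_norm (z : ℂ) : ‖Complex.exp z - 1‖ ≤ Real.exp ‖z‖ - 1 := by
  have := Complex.norm_exp_sub_sum_le_exp_norm_sub_sum z 1
  simpa using this

theorem exp_mul_sub_one_le {θ x : ℝ} (h0 : 0 ≤ θ) (h1 : θ ≤ 1) :
    Real.exp (θ * x) - 1 ≤ θ * (Real.exp x - 1) := by
  have := convexOn_exp.2 (Set.mem_univ (0 : ℝ)) (Set.mem_univ x) (sub_nonneg.2 h1) h0 (by ring)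
  simp only [smul_eq_mul, mul_zero, zero_add, Real.exp_zero] at this
  linarith

/-- The logarithm is traded for a small power while a full factor `ε` is kept: the bound on `‖z‖` is
`θ (γ / 4 + γ log u)` with `θ = 4 ε / γ ≤ 1`, and convexity pulls `θ` out of the exponential. -/
theorem norm_exp_sub_one_le_rpow {γ ε u : ℝ} {z : ℂ} (hγ : 0 < γ) (hγ1 : γ ≤ 1) (hε : 0 ≤ ε)
    (hεγ : ε ≤ γ / 4) (hu : 1 ≤ u) (hz : ‖z‖ ≤ ε * (1 + 4 * Real.log u)) :
    ‖Complex.exp z - 1‖ ≤ 12 * ε / γ * u ^ γ := by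
  have hu0 : 0 < u := by linarith
  have hl : 0 ≤ Real.log u := Real.log_nonneg hu
  have h1 : ε * (1 + 4 * Real.log u) = 4 * ε / γ * (γ / 4 + Real.log u * γ) := by
    field_simp
  calc _ ≤ Real.exp ‖z‖ - 1 := norm_exp_sub_one_le_exp_norm z
    _ ≤ Real.exp (4 * ε / γ * (γ / 4 + Real.log u * γ)) - 1 := by
        rw [← h1]; gcongr
    _ ≤ 4 * ε / γ * (Real.exp (γ / 4 + Real.log u * γ) - 1) :=
        exp_mul_sub_one_le (by positivity) (by rw [div_le_one hγ]; linarith)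
    _ ≤ 4 * ε / γ * (3 * u ^ γ) := by
        have h3 : Real.exp (γ / 4) ≤ 3 :=
          (Real.exp_le_exp.2 (by linarith : γ / 4 ≤ 1)).trans
            (Real.exp_one_lt_d9.le.trans (by norm_num))
        have h4 : Real.exp (γ / 4 + Real.log u * γ) ≤ 3 * u ^ γ := by
          rw [Real.exp_add, Real.rpow_def_of_pos hu0]
          gcongr
        gcongr
        linarith
    _ = _ := by ring

/-- `exp (∑_{j ≤ n} e_j / j)`. -/
noncomputable def expSum (e : ℕ → ℂ) (n : ℕ) : ℂ := Complex.exp (∑ j ∈ Icc 1 n, e j / (j : ℂ))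

theorem expSum_ne_zero (e : ℕ → ℂ) (n : ℕ) : expSum e n ≠ 0 := Complex.exp_ne_zero _

section Small

variable {s ρ b : ℝ} {g : ℕ → ℂ} {d : ℕ → ℝ}

/-- The terms of `e` are bounded by `ε (2 + h)` for a nonnegative `h` of logarithmic mass at
most `1`. -/
def IsLogBounded (ε : ℝ) (e : ℕ → ℂ) : Prop :=
  ∃ h : ℕ → ℝ, (∀ j, 1 ≤ j → ‖e j‖ ≤ ε * (2 + h j) ∧ 0 ≤ h j) ∧
    ∀ n, ∑ j ∈ Icc 1 n, h j / j ≤ 1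

theorem IsLogSmall.isLogBounded (hg : IsLogSmall s ρ g) (hs : 1 ≤ s) (hρ : 0 ≤ ρ) (hb : 0 ≤ b)
    (hd : ∀ j, 1 ≤ j → 0 ≤ d j ∧ d j ≤ b) :
    IsLogBounded (b * ρ) fun j => (d j : ℂ) * g j := by
  obtain ⟨t, h, hth, hsum⟩ := hg
  refine ⟨h, fun j hj => ⟨?_, (hth j hj).2.2.2⟩, hsum⟩
  obtain ⟨h1, h2, h3, h4⟩ := hth j hj
  rw [norm_mul, Complex.norm_real, Real.norm_of_nonneg (hd j hj).1]
  have := le_one_add_rpow h2 hs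
  calc d j * ‖g j‖ ≤ b * (ρ * (2 + h j)) := by
        have := (hd j hj).2
        gcongr
        exact h1.trans (by gcongr; linarith)
    _ = _ := by ring

variable {ε γ : ℝ} {e : ℕ → ℂ}

theorem IsLogBounded.norm_sum_Ioc_le (he : IsLogBounded ε e) (hε : 0 ≤ ε) {i n : ℕ} (hin : i ≤ n) :
    ‖∑ j ∈ Ioc i n, e j / (j : ℂ)‖
      ≤ ε * (1 + 4 * Real.log (((n : ℝ) + 1) / ((i : ℝ) + 1))) := by
  obtain ⟨h, h1, h2⟩ := he
  have h3 : ∑ j ∈ Ioc i n, h j / (j : ℝ) ≤ 1 := by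
    refine le_trans (sum_le_sum_of_subset_of_nonneg ?_ ?_) (h2 n)
    · intro j hj; rw [mem_Ioc] at hj; rw [mem_Icc]; omega
    · intro j hj _
      exact div_nonneg (h1 j (mem_Icc.1 hj).1).2 (Nat.cast_nonneg j)
  calc _ ≤ ∑ j ∈ Ioc i n, ε * (2 * (1 / (j : ℝ)) + h j / j) := by
        refine (norm_sum_le _ _).trans (sum_le_sum fun j hj => ?_)
        rw [norm_div, Complex.norm_natCast]
        have hj1 : 1 ≤ j := by have := (mem_Ioc.1 hj).1; omega
        calc ‖e j‖ / (j : ℝ) ≤ ε * (2 + h j) / j := by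
              gcongr; exact (h1 j hj1).1
          _ = _ := by ring
    _ = ε * (2 * ∑ j ∈ Ioc i n, 1 / (j : ℝ) + ∑ j ∈ Ioc i n, h j / (j : ℝ)) := by
        rw [← mul_sum, sum_add_distrib, ← mul_sum]
    _ ≤ _ := by
        have := sum_Ioc_inv_le hin
        exact mul_le_mul_of_nonneg_left (by linarith) hε

theorem sum_Icc_add_sum_Ioc (f : ℕ → ℂ) {i n : ℕ} (hin : i ≤ n) :
    ∑ j ∈ Icc 1 i, f j + ∑ j ∈ Ioc i n, f j = ∑ j ∈ Icc 1 n, f j := by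
  have h (m : ℕ) : Icc 1 m = Ioc 0 m := by ext; simp; omega
  rw [h, h, sum_Ioc_consecutive f (Nat.zero_le i) hin]

theorem IsLogBounded.norm_expSum_sub_le_of_ge (he : IsLogBounded ε e) (hγ : 0 < γ) (hγ1 : γ ≤ 1)
    (hε : 0 ≤ ε) (hεγ : ε ≤ γ / 4) {i n : ℕ} (hin : n ≤ i) :
    ‖expSum e i - expSum e n‖
      ≤ 12 * ε / γ * (((i : ℝ) + 1) / ((n : ℝ) + 1)) ^ γ * ‖expSum e n‖ := by
  have h1 : expSum e i = expSum e n * Complex.exp (∑ j ∈ Ioc n i, e j / (j : ℂ)) := by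
    rw [expSum, expSum, ← Complex.exp_add, sum_Icc_add_sum_Ioc _ hin]
  rw [show expSum e i - expSum e n
    = (Complex.exp (∑ j ∈ Ioc n i, e j / (j : ℂ)) - 1) * expSum e n by rw [h1]; ring, norm_mul]
  gcongr
  refine norm_exp_sub_one_le_rpow hγ hγ1 hε hεγ ?_ (he.norm_sum_Ioc_le hε hin)
  rw [one_le_div (by positivity)]
  gcongr

theorem IsLogBounded.norm_expSum_sub_le_of_le (he : IsLogBounded ε e) (hγ : 0 < γ) (hγ1 : γ ≤ 1)
    (hε : 0 ≤ ε) (hεγ : ε ≤ γ / 4) {i n : ℕ} (hin : i ≤ n) :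
    ‖expSum e i - expSum e n‖
      ≤ 12 * ε / γ * (((n : ℝ) + 1) / ((i : ℝ) + 1)) ^ γ * ‖expSum e n‖ := by
  have h1 : expSum e i = expSum e n * Complex.exp (-∑ j ∈ Ioc i n, e j / (j : ℂ)) := by
    rw [expSum, expSum, ← Complex.exp_add, ← sum_Icc_add_sum_Ioc _ hin]
    congr 1; ring
  rw [show expSum e i - expSum e n
    = (Complex.exp (-∑ j ∈ Ioc i n, e j / (j : ℂ)) - 1) * expSum e n by rw [h1]; ring, norm_mul]
  gcongr
  refine norm_exp_sub_one_le_rpow hγ hγ1 hε hεγ ?_ ?_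
  · rw [one_le_div (by positivity)]
    gcongr
  · rw [norm_neg]; exact he.norm_sum_Ioc_le hε hin

theorem sum_Ioc_abelRadius_pow_le {a b : ℝ} (ha : 0 < a) (hb : 1 ≤ b) (n m : ℕ) :
    ∑ j ∈ Ioc n m, abelRadius a b n ^ j ≤ (n + 1) / abelExp a b := by
  have hK := abelExp_pos ha hb
  have hr0 := abelRadius_pos a b n
  have hr1 := abelRadius_lt_one ha hb n
  set r := abelRadius a b n with hr
  have h1 : ∑ j ∈ Ioc n m, r ^ j ≤ r / (1 - r) := by
    have h2 : ∑ j ∈ Ioc 0 m, r ^ j ≤ r / (1 - r) := by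
      have hs : HasSum (fun j : ℕ => r * r ^ j) (r * (1 - r)⁻¹) :=
        (hasSum_geometric_of_lt_one hr0.le hr1).mul_left r
      have h3 := sum_le_hasSum (range m) (fun j _ => by positivity) hs
      rw [div_eq_mul_inv]
      refine le_trans (le_of_eq ?_) h3
      have h4 := Finset.sum_Ico_add' (fun j => r ^ j) 0 m 1
      rw [range_eq_Ico, show Ioc 0 m = Ico (0 + 1) (m + 1) by ext; simp; omega, ← h4]
      exact sum_congr rfl fun j _ => by rw [pow_succ]; ring
    refine le_trans (sum_le_sum_of_subset_of_nonneg ?_ fun j _ _ => by positivity) h2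
    intro j hj; rw [mem_Ioc] at hj ⊢; omega
  refine h1.trans ?_
  have h5 := exp_neg_div_one_sub_le (x := abelExp a b / ((n : ℝ) + 1)) (by positivity)
  rw [one_div_div] at h5
  exact h5

/-- Smoothing the sum by `r ^ j` instead of cutting it at `n` changes the exponent by `O(ε)`. For `j
≤ n` one has `1 - r ^ j ≤ K j / (n + 1)`, beyond `n` the geometric decay of `r ^ j` takes over, and
`h` costs at most its total logarithmic mass. -/
theorem IsLogBounded.norm_exp_abel_sub_le {a b : ℝ} (ha : 0 < a) (hb : 1 ≤ b)
    (he : IsLogBounded ε e) (hε : 0 ≤ ε) (hεK : 5 * abelExp a b * ε ≤ 1)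
    {N : ℕ} (hN : ∀ j, N < j → e j = 0) (n : ℕ) :
    ‖Complex.exp (∑ j ∈ Icc 1 N, e j / (j : ℂ) * (abelRadius a b n : ℂ) ^ j) - expSum e n‖
      ≤ 10 * abelExp a b * ε * ‖expSum e n‖ := by
  have hK : 1 ≤ abelExp a b := by
    have : 0 ≤ 8 * b ^ 2 / a := by positivity
    unfold abelExp; linarith
  have hr0 := abelRadius_pos a b n
  have hr1 := abelRadius_lt_one ha hb n
  set r := abelRadius a b n with hr
  set K := abelExp a b with hKdef
  set m := max N n with hm
  have hext : ∑ j ∈ Icc 1 N, e j / (j : ℂ) * (r : ℂ) ^ j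
      = ∑ j ∈ Icc 1 m, e j / (j : ℂ) * (r : ℂ) ^ j := by
    rw [← sum_Icc_add_sum_Ioc _ (le_max_left N n), sum_eq_zero (s := Ioc N m), add_zero]
    intro j hj
    rw [hN j (mem_Ioc.1 hj).1]; simp
  set z : ℂ := ∑ j ∈ Icc 1 n, e j / (j : ℂ) * ((r : ℂ) ^ j - 1)
    + ∑ j ∈ Ioc n m, e j / (j : ℂ) * (r : ℂ) ^ j with hz
  have hexp : Complex.exp (∑ j ∈ Icc 1 N, e j / (j : ℂ) * (r : ℂ) ^ j)
      = Complex.exp z * expSum e n := by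
    rw [hext, expSum, ← Complex.exp_add, ← sum_Icc_add_sum_Ioc _ (le_max_right N n), hz]
    congr 1
    simp_rw [mul_sub, mul_one, sum_sub_distrib]
    ring
  have hzn : ‖z‖ ≤ 5 * K * ε := by
    obtain ⟨h, h1, h2⟩ := he
    have hA : ‖∑ j ∈ Icc 1 n, e j / (j : ℂ) * ((r : ℂ) ^ j - 1)‖
        ≤ ε * (2 * K + ∑ j ∈ Icc 1 n, h j / (j : ℝ)) := by
      calc _ ≤ ∑ j ∈ Icc 1 n, ε * (2 * K / ((n : ℝ) + 1) + h j / j) := by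
            refine (norm_sum_le _ _).trans (sum_le_sum fun j hj => ?_)
            have hj1 := (mem_Icc.1 hj).1
            have hj0 : (0 : ℝ) < j := by exact_mod_cast hj1
            have hrj : r ^ j ≤ 1 := pow_le_one₀ hr0.le hr1.le
            have hrj0 : 0 < r ^ j := by positivity
            have hrK : 1 - r ^ j ≤ K * j / ((n : ℝ) + 1) := by
              rw [hr, abelRadius_pow]
              have := Real.add_one_le_exp (-(abelExp a b * j / ((n : ℝ) + 1)))
              linarith
            have hn : ‖(r : ℂ) ^ j - 1‖ = 1 - r ^ j := by
              rw [show (r : ℂ) ^ j - 1 = ((r ^ j - 1 : ℝ) : ℂ) by push_cast; rfl,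
                Complex.norm_real, Real.norm_eq_abs, abs_of_nonpos (by linarith)]
              ring
            have hh := (h1 j hj1).2
            rw [norm_mul, norm_div, Complex.norm_natCast, hn]
            calc ‖e j‖ / (j : ℝ) * (1 - r ^ j) ≤ ε * (2 + h j) / j * (1 - r ^ j) := by
                  have := (h1 j hj1).1
                  have : 0 ≤ 1 - r ^ j := by linarith
                  gcongr
              _ = ε * (2 * (1 - r ^ j) / j + h j / j * (1 - r ^ j)) := by ring
              _ ≤ ε * (2 * (K * j / ((n : ℝ) + 1)) / j + h j / j * 1) := by
                  gcongr
                  linarith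
              _ = _ := by field_simp
        _ = ε * (2 * K * (n / ((n : ℝ) + 1)) + ∑ j ∈ Icc 1 n, h j / (j : ℝ)) := by
            rw [← mul_sum, sum_add_distrib, sum_const, Nat.card_Icc, nsmul_eq_mul]
            simp only [Nat.add_sub_cancel]
            ring
        _ ≤ _ := by
            have : (n : ℝ) / ((n : ℝ) + 1) ≤ 1 := by
              rw [div_le_one (by positivity)]; linarith
            exact mul_le_mul_of_nonneg_left (by nlinarith) hε
    have hB : ‖∑ j ∈ Ioc n m, e j / (j : ℂ) * (r : ℂ) ^ j‖
        ≤ ε * (2 + ∑ j ∈ Ioc n m, h j / (j : ℝ)) := by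
      calc _ ≤ ∑ j ∈ Ioc n m, ε * (2 / ((n : ℝ) + 1) * r ^ j + h j / j) := by
            refine (norm_sum_le _ _).trans (sum_le_sum fun j hj => ?_)
            have hnj := (mem_Ioc.1 hj).1
            have hj1 : 1 ≤ j := by omega
            have hnj' : (n : ℝ) + 1 ≤ j := by exact_mod_cast hnj
            have hrj : r ^ j ≤ 1 := pow_le_one₀ hr0.le hr1.le
            have hh := (h1 j hj1).2
            rw [norm_mul, norm_div, Complex.norm_natCast, norm_pow, Complex.norm_real,
              Real.norm_of_nonneg hr0.le]
            calc ‖e j‖ / (j : ℝ) * r ^ j ≤ ε * (2 + h j) / j * r ^ j := by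
                  have := (h1 j hj1).1
                  gcongr
              _ = ε * (2 / j * r ^ j + h j / j * r ^ j) := by ring
              _ ≤ ε * (2 / ((n : ℝ) + 1) * r ^ j + h j / j * 1) := by gcongr
              _ = _ := by ring
        _ = ε * (2 / ((n : ℝ) + 1) * ∑ j ∈ Ioc n m, r ^ j + ∑ j ∈ Ioc n m, h j / (j : ℝ)) := by
            rw [← mul_sum, sum_add_distrib, ← mul_sum]
        _ ≤ ε * (2 / ((n : ℝ) + 1) * (((n : ℝ) + 1) / K) + ∑ j ∈ Ioc n m, h j / (j : ℝ)) := by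
            gcongr
            exact sum_Ioc_abelRadius_pow_le ha hb n m
        _ ≤ _ := by
            gcongr
            have : 2 / ((n : ℝ) + 1) * (((n : ℝ) + 1) / K) = 2 / K := by field_simp
            rw [this, div_le_iff₀ (by linarith)]
            linarith
    have hC : ∑ j ∈ Icc 1 n, h j / (j : ℝ) + ∑ j ∈ Ioc n m, h j / (j : ℝ) ≤ 1 := by
      have hI (k : ℕ) : Icc 1 k = Ioc 0 k := by ext; simp; omega
      have := h2 m
      rw [hI] at this ⊢
      rwa [sum_Ioc_consecutive _ (Nat.zero_le n) (le_max_right N n)]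
    calc ‖z‖ ≤ ε * (2 * K + ∑ j ∈ Icc 1 n, h j / (j : ℝ))
          + ε * (2 + ∑ j ∈ Ioc n m, h j / (j : ℝ)) := (norm_add_le _ _).trans (add_le_add hA hB)
      _ = ε * (2 * K + 2 + (∑ j ∈ Icc 1 n, h j / (j : ℝ) + ∑ j ∈ Ioc n m, h j / (j : ℝ))) := by
          ring
      -- Both `2` and the logarithmic mass are absorbed using `1 ≤ K`.
      _ ≤ ε * (2 * K + 2 * K + K) := by gcongr <;> linarith
      _ = _ := by ring
  rw [hexp, show Complex.exp z * expSum e n - expSum e n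
    = (Complex.exp z - 1) * expSum e n by ring, norm_mul]
  gcongr
  refine (Complex.norm_exp_sub_one_le (hzn.trans hεK)).trans ?_
  linarith

theorem sum_range_sub_eq_sum_Icc (f : ℕ → ℝ) (n : ℕ) :
    ∑ i ∈ range n, f (n - i) = ∑ j ∈ Icc 1 n, f j := by
  rw [← sum_range_reflect, show Icc 1 n = Ico (0 + 1) (n + 1) by ext; simp,
    ← Finset.sum_Ico_add' f 0 n 1, range_eq_Ico]
  refine sum_congr rfl fun i hi => ?_
  have := (mem_Ico.1 hi).2
  congr 1; omega

/-- Young's inequality with exponents `s` and `s / (s - 1)` separates `t (n - i)` from the singular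
weight `u ^ (1 - a + γ)`, where `u = (n + 1) / (i + 1)`. The weight becomes `u ^ c`, summable to
order `n` because `c < 1`; for some `γ > 0` this requires `s > 1 / a`. -/
theorem IsLogSmall.sum_norm_mul_le {a : ℝ} (ha : 0 < a) (ha1 : a ≤ 1) (hb : 1 ≤ b)
    (hd : ∀ j, 1 ≤ j → a ≤ d j ∧ d j ≤ b) (hs : 1 < s) (hρ : 0 ≤ ρ) (hg : IsLogSmall s ρ g)
    (hγ : 0 ≤ γ) (hc : (1 - a + γ) * (s / (s - 1)) < 1) (n : ℕ) :
    ∑ i ∈ range n, ‖(d (n - i) : ℂ) * g (n - i)‖ *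
        (pCoeff d i * (((n : ℝ) + 1) / ((i : ℝ) + 1)) ^ γ)
      ≤ 2 * b ^ 2 / a * (2 + 2 / (1 - (1 - a + γ) * (s / (s - 1)))) * ρ * (n * pCoeff d n) := by
  obtain ⟨t, h, hth, hsum⟩ := hg
  have hp := pCoeff_pos ha hd n
  have hs1 : 0 < s - 1 := by linarith
  have hs0 : 0 < s := by linarith
  set c := (1 - a + γ) * (s / (s - 1)) with hcdef
  have hc0 : 0 ≤ c := mul_nonneg (by linarith) (by positivity)
  have hconj : s.HolderConjugate (s / (s - 1)) := Real.HolderConjugate.conjExponent hs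
  have hterm (i : ℕ) (hi : i ∈ range n) : ‖(d (n - i) : ℂ) * g (n - i)‖ *
        (pCoeff d i * (((n : ℝ) + 1) / ((i : ℝ) + 1)) ^ γ)
      ≤ 2 * b ^ 2 / a * ρ * pCoeff d n *
        (1 + h (n - i) + (((n : ℝ) + 1) / ((i : ℝ) + 1)) ^ c) := by
    have hi' := mem_range.1 hi
    obtain ⟨h1, h2, h3, h4⟩ := hth (n - i) (by omega)
    obtain ⟨hd1, hd2⟩ := hd (n - i) (by omega)
    set u : ℝ := ((n : ℝ) + 1) / ((i : ℝ) + 1) with hu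
    have hu0 : 0 < u := by positivity
    have hpi := pCoeff_le_of_le ha ha1 hb hd hi'.le
    have hy : t (n - i) * u ^ (1 - a + γ) ≤ 1 + h (n - i) + u ^ c := by
      have hx0 : 0 ≤ u ^ (1 - a + γ) := by positivity
      have := Real.young_inequality_of_nonneg h2 hx0 hconj
      rw [← Real.rpow_mul hu0.le, ← hcdef] at this
      have e1 : t (n - i) ^ s / s ≤ t (n - i) ^ s :=
        div_le_self (Real.rpow_nonneg h2 s) hs.le
      have e2 : u ^ c / (s / (s - 1)) ≤ u ^ c :=
        div_le_self (by positivity) hconj.symm.lt.le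
      linarith
    rw [norm_mul, Complex.norm_real, Real.norm_of_nonneg (by linarith)]
    calc d (n - i) * ‖g (n - i)‖ * (pCoeff d i * u ^ γ)
        ≤ b * (ρ * t (n - i)) * ((2 * b / a * pCoeff d n * u ^ (1 - a)) * u ^ γ) := by
          have := (pCoeff_pos ha hd i).le
          gcongr
      _ = 2 * b ^ 2 / a * ρ * pCoeff d n * (t (n - i) * u ^ (1 - a + γ)) := by
          rw [Real.rpow_add hu0]; ring
      _ ≤ _ := by gcongr
  refine (sum_le_sum hterm).trans ?_
  rw [← mul_sum, sum_add_distrib, sum_add_distrib]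
  have h1 := sum_div_rpow_le hc0 hc n
  have h2 : ∑ i ∈ range n, h (n - i) ≤ n := by
    rw [sum_range_sub_eq_sum_Icc]
    -- Since `j ≤ n`, logarithmic mass at most `1` gives ordinary mass at most `n`.
    calc ∑ j ∈ Icc 1 n, h j ≤ ∑ j ∈ Icc 1 n, n * (h j / j) := by
          refine sum_le_sum fun j hj => ?_
          obtain ⟨hj1, hj2⟩ := mem_Icc.1 hj
          have hj0 : (0 : ℝ) < j := by exact_mod_cast hj1
          have hjn : (j : ℝ) ≤ n := by exact_mod_cast hj2
          have := (hth j hj1).2.2.2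
          rw [← mul_div_assoc, le_div_iff₀ hj0, mul_comm]
          gcongr
      _ = n * ∑ j ∈ Icc 1 n, h j / j := by rw [mul_sum]
      _ ≤ n * 1 := by gcongr; exact hsum n
      _ = n := mul_one _
  calc _ ≤ 2 * b ^ 2 / a * ρ * pCoeff d n * (n + n + 2 / (1 - c) * n) := by
        gcongr
        simp
    _ = _ := by ring

end Small


/-! ### The contraction step. -/

section Core

variable {a b γ : ℝ} {d : ℕ → ℝ}

theorem summable_pCoeff_mul_abelRadius_pow (ha : 0 < a) (ha1 : a ≤ 1) (hb : 1 ≤ b)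
    (hd : ∀ j, 1 ≤ j → a ≤ d j ∧ d j ≤ b) {n : ℕ} (hn : 1 ≤ n) :
    Summable fun i => pCoeff d i * abelRadius a b n ^ i := by
  have h := (tail_le ha ha1 hb hd hn (zero_le_one : (0 : ℝ) ≤ 1)).1
  simp only [Real.rpow_zero, mul_one] at h
  rw [← summable_nat_add_iff n]
  exact h.congr fun l => by rw [add_comm]

theorem summable_norm_expCoeff_mul_pow {e : ℕ → ℂ} {N : ℕ} (he : ∀ j, N < j → e j = 0) (r : ℝ) :
    Summable fun k => ‖expCoeff e k * (r : ℂ) ^ k‖ :=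
  (hasSum_expCoeff he (r : ℂ)).summable.norm

theorem hasSum_expCoeff_add (ha : 0 < a) (ha1 : a ≤ 1) (hb : 1 ≤ b)
    (hd : ∀ j, 1 ≤ j → a ≤ d j ∧ d j ≤ b) {e : ℕ → ℂ} {N : ℕ} (he : ∀ j, N < j → e j = 0)
    {n : ℕ} (hn : 1 ≤ n) :
    HasSum (fun i => expCoeff (fun j => (d j : ℂ) + e j) i * (abelRadius a b n : ℂ) ^ i)
      (((∑' i, pCoeff d i * abelRadius a b n ^ i : ℝ) : ℂ) *
        Complex.exp (∑ j ∈ Icc 1 N, e j / (j : ℂ) * (abelRadius a b n : ℂ) ^ j)) := by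
  set r := abelRadius a b n
  have hp := summable_pCoeff_mul_abelRadius_pow ha ha1 hb hd hn
  have hpc : Summable fun i => ‖((pCoeff d i * r ^ i : ℝ) : ℂ)‖ := by
    simp_rw [Complex.norm_real]; exact hp.norm
  have hg := summable_norm_expCoeff_mul_pow he r
  have h := summable_norm_sum_mul_range_of_summable_norm hpc hg
  have h2 := tsum_mul_tsum_eq_tsum_sum_range_of_summable_norm hpc hg
  rw [← Complex.ofReal_tsum, (hasSum_expCoeff he (r : ℂ)).tsum_eq] at h2
  rw [h2]
  refine h.of_norm.hasSum.congr_fun fun i => ?_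
  rw [expCoeff_add, sum_mul]
  refine sum_congr rfl fun k hk => ?_
  have hk' : k ≤ i := by have := mem_range.1 hk; omega
  rw [expCoeff_ofReal]
  push_cast
  rw [show (r : ℂ) ^ i = (r : ℂ) ^ k * (r : ℂ) ^ (i - k) by
    rw [← pow_add, Nat.add_sub_cancel' hk']]
  ring

/-- A crude bound whose constant depends on `e`; it serves only to make the supremum of the relative
errors finite. The growth ratio of the coefficients is at most `2 ^ (n - i)`, and the series of `e`
converges absolutely at `2`. -/
theorem norm_expCoeff_add_le (ha : 0 < a) (ha1 : a ≤ 1) (hb : 1 ≤ b)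
    (hd : ∀ j, 1 ≤ j → a ≤ d j ∧ d j ≤ b) {e : ℕ → ℂ} {N : ℕ} (he : ∀ j, N < j → e j = 0) (n : ℕ) :
    ‖expCoeff (fun j => (d j : ℂ) + e j) n‖
      ≤ 2 * b / a * (∑' k, ‖expCoeff e k * ((2 : ℝ) : ℂ) ^ k‖) * pCoeff d n := by
  have hp := pCoeff_pos ha hd n
  have hterm (i : ℕ) (hi : i ∈ range (n + 1)) :
      ‖expCoeff (fun j => (d j : ℂ)) i * expCoeff e (n - i)‖
        ≤ 2 * b / a * pCoeff d n * ‖expCoeff e (n - i) * ((2 : ℝ) : ℂ) ^ (n - i)‖ := by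
    have hi' : i ≤ n := by have := mem_range.1 hi; omega
    rw [expCoeff_ofReal, norm_mul, norm_mul, norm_pow, Complex.norm_real, Complex.norm_real,
      Real.norm_of_nonneg (pCoeff_pos ha hd i).le, Real.norm_of_nonneg (by norm_num : (0 : ℝ) ≤ 2)]
    have h1 := pCoeff_le_of_le ha ha1 hb hd hi'
    have h2 : (((n : ℝ) + 1) / ((i : ℝ) + 1)) ^ (1 - a) ≤ (2 : ℝ) ^ (n - i) := by
      have hu1 : 1 ≤ ((n : ℝ) + 1) / ((i : ℝ) + 1) := by
        rw [one_le_div (by positivity)]; gcongr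
      calc (((n : ℝ) + 1) / ((i : ℝ) + 1)) ^ (1 - a)
          ≤ (((n : ℝ) + 1) / ((i : ℝ) + 1)) ^ (1 : ℝ) :=
            Real.rpow_le_rpow_of_exponent_le hu1 (by linarith)
        _ = ((n : ℝ) + 1) / ((i : ℝ) + 1) := Real.rpow_one _
        _ ≤ ((n - i : ℕ) : ℝ) + 1 := by
            rw [div_le_iff₀ (by positivity), Nat.cast_sub hi']
            have : (i : ℝ) ≤ n := by exact_mod_cast hi'
            nlinarith [Nat.cast_nonneg (α := ℝ) i]
        _ ≤ (2 : ℝ) ^ (n - i) := by exact_mod_cast Nat.lt_two_pow_self (n := n - i)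
    calc pCoeff d i * ‖expCoeff e (n - i)‖
        ≤ 2 * b / a * pCoeff d n * (2 : ℝ) ^ (n - i) * ‖expCoeff e (n - i)‖ := by
          gcongr
          exact h1.trans (by gcongr)
      _ = _ := by ring
  rw [expCoeff_add]
  refine (norm_sum_le _ _).trans ((sum_le_sum hterm).trans ?_)
  rw [← mul_sum, mul_right_comm]
  gcongr
  have h3 : ∑ i ∈ range (n + 1), ‖expCoeff e (n - i) * ((2 : ℝ) : ℂ) ^ (n - i)‖
      = ∑ i ∈ range (n + 1), ‖expCoeff e i * ((2 : ℝ) : ℂ) ^ i‖ := by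
    rw [← sum_range_reflect (fun i => ‖expCoeff e i * ((2 : ℝ) : ℂ) ^ i‖)]
    rfl
  rw [h3]
  exact (summable_norm_expCoeff_mul_pow he 2).sum_le_tsum _ fun k _ => norm_nonneg _

set_option maxHeartbeats 1000000 in
/-- One step of the contraction: if `M` is within relative error `Y` of `p T` everywhere, then at `n`
it is within relative error `(1 - κ) Y` up to small terms. -/
theorem norm_sub_le_of_recurrence (ha : 0 < a) (ha1 : a ≤ 1) (hb : 1 ≤ b)
    (hd : ∀ j, 1 ≤ j → a ≤ d j ∧ d j ≤ b) (hγ : 0 < γ) (hγa : γ < a) {n : ℕ} (hn : 1 ≤ n)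
    {e M T : ℕ → ℂ} {F : ℂ} {σ c₁ c₂ Y : ℝ} (hσ : 0 ≤ σ) (hσ1 : σ ≤ 1) (hY : 0 ≤ Y)
    (hle : ∀ i, i ≤ n →
      ‖T i - T n‖ ≤ σ * (((n : ℝ) + 1) / ((i : ℝ) + 1)) ^ γ * ‖T n‖)
    (hge : ∀ i, n ≤ i →
      ‖T i - T n‖ ≤ σ * (((i : ℝ) + 1) / ((n : ℝ) + 1)) ^ γ * ‖T n‖)
    (hrec : n * M n = ∑ i ∈ range n, ((d (n - i) : ℂ) + e (n - i)) * M i)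
    (he : ∑ i ∈ range n, ‖e (n - i)‖ * (pCoeff d i * (((n : ℝ) + 1) / ((i : ℝ) + 1)) ^ γ)
      ≤ c₁ * (n * pCoeff d n))
    (hF : ‖F - T n‖ ≤ c₂ * ‖T n‖)
    (hsum : HasSum (fun i => M i * (abelRadius a b n : ℂ) ^ i)
      (((∑' i, pCoeff d i * abelRadius a b n ^ i : ℝ) : ℂ) * F))
    (hM : ∀ i, ‖M i - pCoeff d i * T i‖ ≤ Y * (pCoeff d i * ‖T i‖)) :
    ‖M n - pCoeff d n * T n‖ ≤
      ((1 - a * Real.exp (-abelExp a b) / (2 * b)) * Y +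
        (1 + Y) * (2 * c₁ + 2 * c₂ + σ * (2 * b * (4 * b / (a * (a - γ))) + 1))) *
        (pCoeff d n * ‖T n‖) := by
  have hppos := fun i => pCoeff_pos ha hd i
  have hr0 := abelRadius_pos a b n
  have hr1 := abelRadius_lt_one ha hb n
  have hb0 : 0 < b := by linarith
  have hn0 : (0 : ℝ) < n := by exact_mod_cast hn
  obtain ⟨hts, htl⟩ := tail_le ha ha1 hb hd hn (hγa.le.trans ha1)
  obtain ⟨hts0, htl0⟩ := tail_le ha ha1 hb hd hn (zero_le_one : (0 : ℝ) ≤ 1)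
  simp only [Real.rpow_zero, mul_one] at hts0 htl0
  have hps := summable_pCoeff_mul_abelRadius_pow ha ha1 hb hd hn
  have hhead := head_le ha hb hd n
  have hheadge := head_ge ha hb hd (n := n)
  have hC2 := sum_pCoeff_mul_rpow_le ha ha1 hb hd n hγ.le hγa
  set r := abelRadius a b n with hr
  set p := pCoeff d with hp
  set w := ‖T n‖ with hw
  set D : ℝ := n * p n with hD
  set C := 4 * b / (a * (a - γ)) with hC
  have hw0 : 0 ≤ w := norm_nonneg _
  have hD0 : 0 < D := mul_pos hn0 (hppos n)
  have hrpow (i : ℕ) : r ^ i ≤ 1 := pow_le_one₀ hr0.le hr1.le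
  set H := ∑ i ∈ range n, p i * r ^ i with hH
  have hH0 : 0 ≤ H := sum_nonneg fun i _ => mul_nonneg (hppos i).le (pow_nonneg hr0.le i)
  set U : ℕ → ℝ := fun i => (((n : ℝ) + 1) / ((i : ℝ) + 1)) ^ γ with hU
  set V : ℕ → ℝ := fun l => ((((n + l : ℕ) : ℝ) + 1) / ((n : ℝ) + 1)) ^ γ with hV
  have hU1 (i : ℕ) (hi : i ∈ range n) : 1 ≤ U i := by
    refine Real.one_le_rpow ?_ hγ.le
    rw [one_le_div (by positivity)]
    have := (mem_range.1 hi).le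
    gcongr
  have hTle (i : ℕ) (hi : i ∈ range n) : ‖T i‖ ≤ w + σ * U i * w :=
    (norm_le_norm_add_norm_sub' (T i) (T n)).trans
      (add_le_add_right (hle i (mem_range.1 hi).le) _)
  have hTge (l : ℕ) : ‖T (n + l)‖ ≤ w + σ * V l * w :=
    (norm_le_norm_add_norm_sub' (T (n + l)) (T n)).trans
      (add_le_add_right (hge (n + l) (Nat.le_add_right n l)) _)
  set y : ℕ → ℂ := fun i => M i - p i * T i with hy
  have hyle (i : ℕ) (hi : i ∈ range n) : ‖y i‖ ≤ Y * w * (p i + σ * (p i * U i)) := by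
    have h1 := hTle i hi
    have h2 := (hppos i).le
    calc ‖y i‖ ≤ Y * (p i * ‖T i‖) := hM i
      _ ≤ Y * (p i * (w + σ * U i * w)) := by gcongr
      _ = _ := by ring
  -- the Abel mean of `y`
  set m : ℂ := ((∑' i, p i * r ^ i : ℝ) : ℂ) * (F - T n)
    - (∑ i ∈ range n, ((p i * r ^ i : ℝ) : ℂ) * (T i - T n)
      + ∑' l, ((p (n + l) * r ^ (n + l) : ℝ) : ℂ) * (T (n + l) - T n)) with hm
  have hsT_norm (l : ℕ) : ‖((p (n + l) * r ^ (n + l) : ℝ) : ℂ) * (T (n + l) - T n)‖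
      ≤ σ * w * (p (n + l) * r ^ (n + l) * V l) := by
    have h2 := (hppos (n + l)).le
    rw [norm_mul, Complex.norm_real, Real.norm_of_nonneg (by positivity)]
    calc _ ≤ p (n + l) * r ^ (n + l) * (σ * V l * w) := by
          gcongr; exact hge (n + l) (Nat.le_add_right n l)
      _ = _ := by ring
  have hsTs : Summable fun l => ((p (n + l) * r ^ (n + l) : ℝ) : ℂ) * (T (n + l) - T n) :=
    Summable.of_norm_bounded (hts.mul_left (σ * w)) hsT_norm
  have hysum : HasSum (fun i => y i * (r : ℂ) ^ i) m := by
    have hA : HasSum (fun i => ((p i * r ^ i : ℝ) : ℂ) * (T i - T n))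
        (∑ i ∈ range n, ((p i * r ^ i : ℝ) : ℂ) * (T i - T n)
          + ∑' l, ((p (n + l) * r ^ (n + l) : ℝ) : ℂ) * (T (n + l) - T n)) := by
      have hs : Summable fun i => ((p i * r ^ i : ℝ) : ℂ) * (T i - T n) := by
        rw [← summable_nat_add_iff n]
        exact hsTs.congr fun l => by rw [add_comm n l]
      have := hs.sum_add_tsum_nat_add n
      simp_rw [add_comm n]
      rw [this]
      exact hs.hasSum
    have hB : HasSum (fun i => ((p i * r ^ i : ℝ) : ℂ) * T n)
        (((∑' i, p i * r ^ i : ℝ) : ℂ) * T n) :=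
      (Complex.hasSum_ofReal.2 hps.hasSum).mul_right _
    have := (hsum.sub hB).sub hA
    rw [hm, mul_sub]
    refine this.congr_fun fun i => ?_
    simp only [hy]
    push_cast
    ring
  have hysplit : m = ∑ i ∈ range n, y i * (r : ℂ) ^ i
      + ∑' l, y (n + l) * (r : ℂ) ^ (n + l) := by
    have := hysum.summable.sum_add_tsum_nat_add n
    simp_rw [add_comm n]
    rw [this, hysum.tsum_eq]
  -- the recurrence for `y`
  have hDsum : ∑ i ∈ range n, (d (n - i) : ℂ) * (p i : ℂ) = n * (p n : ℂ) := by
    have := mul_pCoeff d n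
    exact_mod_cast this.symm
  -- Each weight `d (n - i)` on `y i` is split as `a r ^ i` plus a remainder. The part `a r ^ i`,
  -- summed over `i < n`, is `a` times the small Abel mean `m` minus the tail beyond `n`.
  have hyrec : n * y n = ∑ i ∈ range n, e (n - i) * M i
      + ∑ i ∈ range n, (d (n - i) : ℂ) * p i * (T i - T n) + (a : ℂ) * m
      + ∑ i ∈ range n, ((d (n - i) - a * r ^ i : ℝ) : ℂ) * y i
      - (a : ℂ) * ∑' l, y (n + l) * (r : ℂ) ^ (n + l) := by
    have h1 : n * y n = ∑ i ∈ range n, (((d (n - i) : ℂ) + e (n - i)) * M i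
        - (d (n - i) : ℂ) * (p i : ℂ) * T n) := by
      rw [sum_sub_distrib, ← hrec, ← sum_mul, hDsum]
      simp only [hy]; ring
    rw [h1, hysplit, mul_add, mul_sum, ← sum_add_distrib]
    rw [← sub_eq_zero]
    have h2 : ∑ i ∈ range n, (((d (n - i) : ℂ) + e (n - i)) * M i
        - (d (n - i) : ℂ) * (p i : ℂ) * T n) =
        ∑ i ∈ range n, (e (n - i) * M i + (d (n - i) : ℂ) * p i * (T i - T n))
        + ∑ i ∈ range n, (a : ℂ) * (y i * (r : ℂ) ^ i)
        + ∑ i ∈ range n, ((d (n - i) - a * r ^ i : ℝ) : ℂ) * y i := by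
      rw [← sum_add_distrib, ← sum_add_distrib]
      refine sum_congr rfl fun i _ => ?_
      simp only [hy]
      push_cast
      ring
    rw [h2]
    ring
  -- bounds for the five terms
  have b1 : ‖∑ i ∈ range n, e (n - i) * M i‖ ≤ 2 * (1 + Y) * w * (c₁ * D) := by
    calc _ ≤ ∑ i ∈ range n, 2 * (1 + Y) * w * (‖e (n - i)‖ * (p i * U i)) := by
          refine (norm_sum_le _ _).trans (sum_le_sum fun i hi => ?_)
          have h2 := (hppos i).le
          have hMi : ‖M i‖ ≤ (1 + Y) * (p i * ‖T i‖) := by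
            have h3 := norm_le_norm_add_norm_sub' (M i) (p i * T i)
            rw [norm_mul, Complex.norm_real, Real.norm_of_nonneg h2] at h3
            linarith [hM i]
          have hTi : ‖T i‖ ≤ 2 * U i * w := by
            have := hTle i hi
            have h4 := hU1 i hi
            nlinarith [mul_le_mul_of_nonneg_right h4 hw0,
              mul_le_mul_of_nonneg_right hσ1 (mul_nonneg (zero_le_one.trans h4) hw0)]
          rw [norm_mul]
          calc ‖e (n - i)‖ * ‖M i‖ ≤ ‖e (n - i)‖ * ((1 + Y) * (p i * (2 * U i * w))) := by
                gcongr
                exact hMi.trans (by gcongr)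
            _ = _ := by ring
      _ ≤ _ := by
          rw [← mul_sum]
          gcongr
  have b2 : ‖∑ i ∈ range n, (d (n - i) : ℂ) * p i * (T i - T n)‖ ≤ b * σ * w * (C * D) := by
    calc _ ≤ ∑ i ∈ range n, b * σ * w * (p i * U i) := by
          refine (norm_sum_le _ _).trans (sum_le_sum fun i hi => ?_)
          have h2 := (hppos i).le
          have hi' := mem_range.1 hi
          obtain ⟨hd1, hd2⟩ := hd (n - i) (by omega)
          rw [norm_mul, norm_mul, Complex.norm_real, Complex.norm_real, Real.norm_of_nonneg h2,
            Real.norm_of_nonneg (by linarith)]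
          calc _ ≤ b * p i * (σ * U i * w) := by gcongr; exact hle i hi'.le
            _ = _ := by ring
      _ ≤ _ := by
          rw [← mul_sum]
          gcongr
  have hPr : ∑' i, p i * r ^ i ≤ 3 / 2 * H := by
    have := hps.sum_add_tsum_nat_add n
    simp_rw [add_comm _ n] at this
    rw [← this]
    linarith
  have hPr0 : 0 ≤ ∑' i, p i * r ^ i := tsum_nonneg fun i => by
    have := (hppos i).le
    positivity
  have haH : a * H ≤ D := by
    rw [le_div_iff₀ ha] at hhead; linarith
  have b3 : a * ‖m‖ ≤ (2 * c₂ + a * σ * C + σ) * w * D := by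
    have h1 : ‖((∑' i, p i * r ^ i : ℝ) : ℂ) * (F - T n)‖ ≤ 3 / 2 * H * (c₂ * w) := by
      rw [norm_mul, Complex.norm_real, Real.norm_of_nonneg hPr0]
      gcongr
    have h2 : ‖∑ i ∈ range n, ((p i * r ^ i : ℝ) : ℂ) * (T i - T n)‖ ≤ σ * w * (C * D) := by
      calc _ ≤ ∑ i ∈ range n, σ * w * (p i * U i) := by
            refine (norm_sum_le _ _).trans (sum_le_sum fun i hi => ?_)
            have h2 := (hppos i).le
            rw [norm_mul, Complex.norm_real, Real.norm_of_nonneg (by positivity)]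
            calc _ ≤ p i * 1 * (σ * U i * w) := by
                  have := hrpow i
                  gcongr
                  exact hle i (mem_range.1 hi).le
              _ = _ := by ring
        _ ≤ _ := by
            rw [← mul_sum]
            gcongr
    have h3 : ‖∑' l, ((p (n + l) * r ^ (n + l) : ℝ) : ℂ) * (T (n + l) - T n)‖
        ≤ σ * w * (H / 2) := by
      refine (tsum_of_norm_bounded (hts.mul_left (σ * w)).hasSum hsT_norm).trans ?_
      rw [tsum_mul_left]
      gcongr
    have h4 : 0 ≤ c₂ * w := (norm_nonneg _).trans hF
    calc a * ‖m‖ ≤ a * (3 / 2 * H * (c₂ * w) + (σ * w * (C * D) + σ * w * (H / 2))) := by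
          gcongr
          exact (norm_sub_le _ _).trans (add_le_add h1 ((norm_add_le _ _).trans
            (add_le_add h2 h3)))
      _ = 3 / 2 * (a * H) * (c₂ * w) + a * σ * w * (C * D) + σ * w * (a * H / 2) := by ring
      _ ≤ 2 * D * (c₂ * w) + a * σ * w * (C * D) + σ * w * D := by
          have haH0 : 0 ≤ a * H := by positivity
          gcongr <;> linarith
      _ = _ := by ring
  -- The reduced weights remain nonnegative because `r ^ i ≤ 1` and `a ≤ d (n - i)`, so their total
  -- mass against `p` is exactly `D - a H`. This is the source of the gain.
  have b4 : ‖∑ i ∈ range n, ((d (n - i) - a * r ^ i : ℝ) : ℂ) * y i‖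
      ≤ Y * w * (D - a * H + b * σ * (C * D)) := by
    calc _ ≤ ∑ i ∈ range n, Y * w * ((d (n - i) * p i - a * (p i * r ^ i))
          + b * σ * (p i * U i)) := by
          refine (norm_sum_le _ _).trans (sum_le_sum fun i hi => ?_)
          have h2 := (hppos i).le
          have hi' := mem_range.1 hi
          obtain ⟨hd1, hd2⟩ := hd (n - i) (by omega)
          have h3 : a * r ^ i ≤ a := mul_le_of_le_one_right ha.le (hrpow i)
          have h4 : 0 ≤ a * r ^ i := by positivity
          have h5 : 0 ≤ U i := zero_le_one.trans (hU1 i hi)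
          rw [norm_mul, Complex.norm_real, Real.norm_of_nonneg (by linarith)]
          calc _ ≤ (d (n - i) - a * r ^ i) * (Y * w * (p i + σ * (p i * U i))) := by
                have : 0 ≤ d (n - i) - a * r ^ i := by linarith
                gcongr
                exact hyle i hi
            _ = Y * w * ((d (n - i) * p i - a * (p i * r ^ i))
                + (d (n - i) - a * r ^ i) * (σ * (p i * U i))) := by ring
            _ ≤ Y * w * ((d (n - i) * p i - a * (p i * r ^ i)) + b * (σ * (p i * U i))) := by
                gcongr
                linarith
            _ = _ := by ring
      _ = Y * w * (D - a * H + b * σ * ∑ i ∈ range n, p i * U i) := by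
          rw [← mul_sum, sum_add_distrib, sum_sub_distrib, ← mul_sum, ← mul_sum, ← mul_pCoeff]
      _ ≤ _ := by
          gcongr
  have b5 : ‖∑' l, y (n + l) * (r : ℂ) ^ (n + l)‖ ≤ Y * w * (H / 2 + σ * (H / 2)) := by
    have hb5 (l : ℕ) : ‖y (n + l) * (r : ℂ) ^ (n + l)‖
        ≤ Y * w * (p (n + l) * r ^ (n + l) + σ * (p (n + l) * r ^ (n + l) * V l)) := by
      have h2 := (hppos (n + l)).le
      rw [norm_mul, norm_pow, Complex.norm_real, Real.norm_of_nonneg hr0.le]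
      calc _ ≤ Y * (p (n + l) * (w + σ * V l * w)) * r ^ (n + l) := by
            gcongr
            refine (hM (n + l)).trans ?_
            have := hTge l
            gcongr
        _ = _ := by ring
    have hs := ((hts0.hasSum.add (hts.hasSum.mul_left σ)).mul_left (Y * w))
    refine (tsum_of_norm_bounded hs hb5).trans ?_
    gcongr
  -- The head carries a proportion of `D` independent of `n`, so the net gain `a H / 2` is at least
  -- `κ D` with a uniform `κ`.
  have hκ : D * (Real.exp (-abelExp a b) / b) ≤ H := by
    refine le_trans ?_ hheadge
    rw [mul_div_assoc', mul_div_assoc', mul_comm D]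
    gcongr
    rw [div_le_iff₀ (by positivity)]
    have := abelExp_pos ha hb
    nlinarith
  have hfin : n * ‖y n‖ ≤ 2 * (1 + Y) * w * (c₁ * D) + b * σ * w * (C * D)
      + (2 * c₂ + a * σ * C + σ) * w * D + Y * w * (D - a * H + b * σ * (C * D))
      + a * (Y * w * (H / 2 + σ * (H / 2))) := by
    have h1 : (n : ℝ) * ‖y n‖ = ‖(n : ℂ) * y n‖ := by rw [norm_mul, Complex.norm_natCast]
    have hnorm (z : ℂ) : ‖(a : ℂ) * z‖ = a * ‖z‖ := by
      rw [norm_mul, Complex.norm_real, Real.norm_of_nonneg ha.le]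
    rw [h1, hyrec]
    refine (norm_sub_le _ _).trans (add_le_add ?_ ?_)
    · refine (norm_add_le _ _).trans (add_le_add ?_ b4)
      refine (norm_add_le _ _).trans (add_le_add ?_ (by rw [hnorm]; exact b3))
      exact (norm_add_le _ _).trans (add_le_add b1 b2)
    · rw [hnorm]; gcongr
  have hC0 : 0 ≤ C := by
    have : 0 < a - γ := by linarith
    positivity
  have hYw : 0 ≤ Y * w := by positivity
  have hab : a ≤ b := ha1.trans hb
  have hc2w : 0 ≤ c₂ * w := (norm_nonneg _).trans hF
  have e1 : a * (Y * w * (H / 2 + σ * (H / 2))) ≤ Y * w * (a * H / 2 + σ * D) := by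
    have : Y * w * (σ * (a * H / 2)) ≤ Y * w * (σ * D) := by
      gcongr; linarith
    linarith
  have e2 : Y * w * (D - a * H / 2) ≤ Y * w * ((1 - a * Real.exp (-abelExp a b) / (2 * b)) * D) := by
    gcongr
    have : a * (D * (Real.exp (-abelExp a b) / b)) ≤ a * H := by gcongr
    have h2 : a * (D * (Real.exp (-abelExp a b) / b)) / 2
        = a * Real.exp (-abelExp a b) / (2 * b) * D := by field_simp
    linarith
  have e3 : a * σ * C * w * D ≤ b * σ * C * w * D := by gcongr
  have e4 : 0 ≤ Y * (c₂ * w) * D := by positivity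
  have e5 : 0 ≤ Y * (b * σ * C * w * D) := by positivity
  have hfin2 : n * ‖y n‖ ≤ n * (((1 - a * Real.exp (-abelExp a b) / (2 * b)) * Y +
        (1 + Y) * (2 * c₁ + 2 * c₂ + σ * (2 * b * C + 1))) * (p n * w)) := by
    have : n * (((1 - a * Real.exp (-abelExp a b) / (2 * b)) * Y +
        (1 + Y) * (2 * c₁ + 2 * c₂ + σ * (2 * b * C + 1))) * (p n * w)) =
        Y * w * ((1 - a * Real.exp (-abelExp a b) / (2 * b)) * D) +
        (1 + Y) * (2 * c₁ + 2 * c₂ + σ * (2 * b * C + 1)) * (w * D) := by rw [hD]; ring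
    rw [this]
    linarith
  exact le_of_mul_le_mul_left hfin2 hn0

end Core


/-! ### The uniform upper bound for the perturbed coefficients. -/

theorem expSum_min {e : ℕ → ℂ} {N : ℕ} (he : ∀ j, N < j → e j = 0) (n : ℕ) :
    expSum e n = expSum e (min n N) := by
  rcases le_total n N with h | h
  · rw [min_eq_left h]
  · rw [min_eq_right h, expSum, expSum, ← sum_Icc_add_sum_Ioc _ h, sum_eq_zero (s := Ioc N n),
      add_zero]
    intro j hj
    rw [he j (mem_Ioc.1 hj).1, zero_div]

/-- The upper bound of the right order for the perturbed coefficients. -/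
theorem exists_norm_expCoeff_le {a b s : ℝ} (ha : 0 < a) (ha1 : a ≤ 1) (hb : 1 ≤ b)
    (hs : 1 / a < s) :
    ∃ δ : ℝ, 0 < δ ∧ ∀ d : ℕ → ℝ, (∀ j, 1 ≤ j → a ≤ d j ∧ d j ≤ b) →
      ∀ (g : ℕ → ℂ) (N : ℕ), (∀ j, N < j → g j = 0) → ∀ ρ : ℝ, 0 ≤ ρ → ρ ≤ δ →
        IsLogSmall s ρ g → ∀ n, ‖expCoeff (fun j => (d j : ℂ) + (d j : ℂ) * g j) n‖
          ≤ 2 * (pCoeff d n * ‖expSum (fun j => (d j : ℂ) * g j) n‖) := by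
  have has : 1 < a * s := by rw [div_lt_iff₀ ha] at hs; linarith
  have hs1 : 1 < s := lt_of_le_of_lt (by rw [le_div_iff₀ ha]; linarith) hs
  have hs0 : 0 < s := by linarith
  have hb0 : 0 < b := by linarith
  -- This is half of `a - 1 / s`, so `γ > 0`, `γ < a` and `c < 1` hold together.
  set γ : ℝ := (a * s - 1) / (2 * s) with hγdef
  have hγ : 0 < γ := div_pos (by linarith) (by linarith)
  have hγa : γ < a := by
    rw [hγdef, div_lt_iff₀ (by linarith)]; nlinarith
  set c : ℝ := (1 - a + γ) * (s / (s - 1)) with hcdef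
  have hc : c < 1 := by
    have h1 : s - 1 ≠ 0 := by linarith
    have : c = (s - (a * s + 1) / 2) / (s - 1) := by
      rw [hcdef, hγdef]; field_simp; ring
    rw [this, div_lt_one (by linarith)]
    linarith
  set K := abelExp a b with hK
  have hK0 : 0 < K := abelExp_pos ha hb
  set C₁ : ℝ := 2 * b ^ 2 / a * (2 + 2 / (1 - c)) with hC₁
  have hC₁0 : 0 < C₁ := by
    have : 0 < 1 - c := by linarith
    positivity
  set C₂ : ℝ := 2 * b * (4 * b / (a * (a - γ))) + 1 with hC₂
  have hC₂0 : 0 < C₂ := by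
    have : 0 < a - γ := by linarith
    positivity
  set C₃ : ℝ := 2 * C₁ + 20 * K * b + 12 * b / γ * C₂ with hC₃
  have hC₃0 : 0 < C₃ := by positivity
  set κ : ℝ := a * Real.exp (-K) / (2 * b) with hκ
  have hκ0 : 0 < κ := by positivity
  -- The three bounds give, in order: `σ = 12 b ρ / γ ≤ 1`, the smallness required by
  -- `norm_exp_abel_sub_le`, and an error `C₃ ρ` of at most half the contraction gain `κ`.
  refine ⟨min (γ / (12 * b)) (min (1 / (5 * K * b)) (κ / (2 * C₃))), by positivity, ?_⟩
  intro d hd g N hg ρ hρ hρδ hsmall n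
  obtain ⟨hρ1, hρ2⟩ := le_min_iff.1 hρδ
  obtain ⟨hρ2, hρ3⟩ := le_min_iff.1 hρ2
  rw [le_div_iff₀ (by positivity)] at hρ1 hρ2 hρ3
  set e : ℕ → ℂ := fun j => (d j : ℂ) * g j with he
  set M := expCoeff fun j => (d j : ℂ) + e j with hM
  have heN : ∀ j, N < j → e j = 0 := fun j hj => by simp [he, hg j hj]
  have hlog : IsLogBounded (b * ρ) e := hsmall.isLogBounded hs1.le hρ hb0.le
    fun j hj => ⟨ha.le.trans (hd j hj).1, (hd j hj).2⟩
  have hε0 : 0 ≤ b * ρ := by positivity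
  have hεγ : b * ρ ≤ γ / 4 := by linarith
  have hp := fun i => pCoeff_pos ha hd i
  have hT (i : ℕ) : 0 < ‖expSum e i‖ := norm_pos_iff.2 (expSum_ne_zero e i)
  have hpT (i : ℕ) : 0 < pCoeff d i * ‖expSum e i‖ := mul_pos (hp i) (hT i)
  set q : ℕ → ℝ := fun i => ‖M i - pCoeff d i * expSum e i‖ / (pCoeff d i * ‖expSum e i‖) with hq
  -- The contraction is vacuous unless the supremum is known to be finite. As `e` vanishes beyond
  -- `N`, `expSum e` takes finitely many nonzero values, and the crude bound suffices.
  have hbdd : BddAbove (Set.range q) := by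
    set B := 2 * b / a * (∑' k, ‖expCoeff e k * ((2 : ℝ) : ℂ) ^ k‖)
    have hB0 : 0 ≤ B := mul_nonneg (by positivity) (tsum_nonneg fun _ => norm_nonneg _)
    set B' := ∑ k ∈ range (N + 1), ‖expSum e k‖⁻¹
    refine ⟨B * B' + 1, ?_⟩
    rintro _ ⟨i, rfl⟩
    have h1 : ‖expSum e i‖⁻¹ ≤ B' := by
      rw [expSum_min heN]
      refine single_le_sum (f := fun k => ‖expSum e k‖⁻¹)
        (fun k _ => inv_nonneg.2 (norm_nonneg _)) (mem_range.2 ?_)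
      have := min_le_right i N
      omega
    have h2 : ‖M i‖ ≤ B * pCoeff d i := norm_expCoeff_add_le ha ha1 hb hd heN i
    have hTi := hT i
    have hpi := hp i
    calc q i ≤ (‖M i‖ + pCoeff d i * ‖expSum e i‖) / (pCoeff d i * ‖expSum e i‖) := by
          simp only [hq]
          gcongr
          refine (norm_sub_le _ _).trans (le_of_eq ?_)
          rw [norm_mul, Complex.norm_real, Real.norm_of_nonneg (hp i).le]
      _ ≤ (B * pCoeff d i + pCoeff d i * ‖expSum e i‖) / (pCoeff d i * ‖expSum e i‖) := by gcongr
      _ = B * ‖expSum e i‖⁻¹ + 1 := by field_simp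
      _ ≤ B * B' + 1 := by gcongr
  set Y := ⨆ i, q i with hYdef
  have hqY (i : ℕ) : q i ≤ Y := le_ciSup hbdd i
  have hY0 : 0 ≤ Y := le_trans (div_nonneg (norm_nonneg _) (hpT 0).le) (hqY 0)
  have hMY (i : ℕ) : ‖M i - pCoeff d i * expSum e i‖ ≤ Y * (pCoeff d i * ‖expSum e i‖) :=
    (div_le_iff₀ (hpT i)).1 (hqY i)
  have hκ1 : κ ≤ 1 := by
    rw [hκ, div_le_one (by positivity)]
    have : Real.exp (-K) ≤ 1 := Real.exp_le_one_iff.2 (by linarith)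
    nlinarith
  have hstep (i : ℕ) : q i ≤ (1 - κ) * Y + (1 + Y) * (κ / 2) := by
    rcases Nat.eq_zero_or_pos i with rfl | hi
    · have : q 0 = 0 := by
        simp [hq, hM, expCoeff_zero, pCoeff_zero, expSum]
      rw [this]
      have : 0 ≤ 1 - κ := by linarith
      positivity
    · rw [hq]
      simp only
      rw [div_le_iff₀ (hpT i)]
      have := norm_sub_le_of_recurrence ha ha1 hb hd hγ hγa hi (e := e) (M := M)
        (T := expSum e) (σ := 12 * (b * ρ) / γ) (c₁ := C₁ * ρ) (c₂ := 10 * K * (b * ρ)) (Y := Y)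
        (by positivity) (by rw [div_le_one hγ]; linarith) hY0
        (fun k hk => hlog.norm_expSum_sub_le_of_le hγ (hγa.le.trans ha1) hε0 hεγ hk)
        (fun k hk => hlog.norm_expSum_sub_le_of_ge hγ (hγa.le.trans ha1) hε0 hεγ hk)
        (mul_expCoeff _ i)
        (hsmall.sum_norm_mul_le ha ha1 hb hd hs1 hρ hγ.le hc i)
        (hlog.norm_exp_abel_sub_le ha hb hε0 (by linarith) heN i)
        (hasSum_expCoeff_add ha ha1 hb hd heN hi) hMY
      refine this.trans (mul_le_mul_of_nonneg_right ?_ (hpT i).le)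
      have h1 : 2 * (C₁ * ρ) + 2 * (10 * K * (b * ρ)) + 12 * (b * ρ) / γ * C₂ = ρ * C₃ := by
        rw [hC₃]; ring
      rw [h1]
      have h2 : ρ * C₃ ≤ κ / 2 := by linarith
      gcongr
  -- The inequality rearranges to `κ Y / 2 ≤ κ / 2`.
  have hY1 : Y ≤ 1 := by
    have : Y ≤ (1 - κ) * Y + (1 + Y) * (κ / 2) := ciSup_le hstep
    nlinarith
  have h1 := norm_le_norm_add_norm_sub' (M n) (pCoeff d n * expSum e n)
  rw [norm_mul, Complex.norm_real, Real.norm_of_nonneg (hp n).le] at h1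
  have h2 := hMY n
  have h3 := mul_le_mul_of_nonneg_right hY1 (hpT n).le
  linarith

/-! ### Cauchy's estimate and the first-order expansion. -/

/-- The Taylor coefficients are at most `B / W ^ n`; from `n = 2` on they are dominated by a
geometric series of ratio `1 / 2`, because `2 ≤ W`. -/
theorem norm_sub_sub_deriv_le {Φ : ℂ → ℂ} (hΦ : Differentiable ℂ Φ) {B W : ℝ} (hW : 2 ≤ W)
    (hB : ∀ z, ‖z‖ ≤ W → ‖Φ z‖ ≤ B) : ‖Φ 1 - Φ 0 - deriv Φ 0‖ ≤ 2 * B / W ^ 2 := by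
  have hW0 : 0 < W := by linarith
  have hB0 : 0 ≤ B := (norm_nonneg _).trans (hB 0 (by simp; linarith))
  have hs := Complex.hasSum_taylorSeries_of_entire hΦ 0 1
  simp only [sub_zero, one_pow, smul_eq_mul] at hs
  set c : ℕ → ℂ := fun n => ((n.factorial : ℂ))⁻¹ * iteratedDeriv n Φ 0 with hc
  have hcn (n : ℕ) : ‖c n‖ ≤ B / W ^ n := by
    have h1 := Complex.norm_iteratedDeriv_le_of_forall_mem_sphere_norm_le (c := 0) n hW0
      hΦ.diffContOnCl (C := B) (fun z hz => hB z (by simpa using (mem_sphere_zero_iff_norm.1 hz).le))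
    have hf : (0 : ℝ) < n.factorial := by exact_mod_cast n.factorial_pos
    rw [hc, norm_mul, norm_inv, Complex.norm_natCast, inv_mul_le_iff₀ hf]
    refine h1.trans (le_of_eq ?_)
    ring
  have h2 : ∑' n, c (n + 2) = Φ 1 - Φ 0 - deriv Φ 0 := by
    have := hs.summable.sum_add_tsum_nat_add 2
    rw [hs.tsum_eq] at this
    rw [← this]
    simp [sum_range_succ, iteratedDeriv_one]
    ring
  have hg : HasSum (fun n : ℕ => B / W ^ 2 * (1 / 2 : ℝ) ^ n) (B / W ^ 2 * 2) :=
    hasSum_geometric_two.mul_left _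
  rw [← h2]
  refine (tsum_of_norm_bounded hg fun n => ?_).trans (le_of_eq (by ring))
  refine (hcn (n + 2)).trans ?_
  rw [pow_add, mul_comm (W ^ n), ← div_div, div_eq_mul_one_div _ (W ^ n), ← one_div_pow]
  gcongr

theorem differentiable_expCoeff_mul (e : ℕ → ℂ) (k : ℕ) :
    Differentiable ℂ fun w : ℂ => expCoeff (fun j => w * e j) k := by
  induction k using Nat.strong_induction_on with
  | _ k ih =>
    rcases Nat.eq_zero_or_pos k with rfl | hk
    · simp_rw [expCoeff_zero]; exact differentiable_const _
    · have hk0 : (k : ℂ) ≠ 0 := by exact_mod_cast hk.ne'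
      have h : (fun w : ℂ => expCoeff (fun j => w * e j) k)
          = fun w => (∑ i ∈ range k, w * e (k - i) * expCoeff (fun j => w * e j) i) / k := by
        ext w
        rw [eq_div_iff hk0, mul_comm, mul_expCoeff]
      rw [h]
      refine (Differentiable.fun_sum fun i hi => ?_).div_const _
      exact ((differentiable_id.mul_const _).mul (ih i (mem_range.1 hi)))

theorem expCoeff_zero_mul (e : ℕ → ℂ) {k : ℕ} (hk : 1 ≤ k) :
    expCoeff (fun j => (0 : ℂ) * e j) k = 0 := by
  have hk0 : (k : ℂ) ≠ 0 := by exact_mod_cast (by omega : k ≠ 0)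
  apply mul_left_cancel₀ hk0
  rw [mul_expCoeff]
  simp

/-- The recurrence exhibits the coefficient as `w * H w`, so its derivative at `0` is `H 0`, where
only the term `i = 0` survives. -/
theorem hasDerivAt_expCoeff_mul (e : ℕ → ℂ) {k : ℕ} (hk : 1 ≤ k) :
    HasDerivAt (fun w : ℂ => expCoeff (fun j => w * e j) k) (e k / k) 0 := by
  have hk0 : (k : ℂ) ≠ 0 := by exact_mod_cast (by omega : k ≠ 0)
  set H : ℂ → ℂ := fun w => (∑ i ∈ range k, e (k - i) * expCoeff (fun j => w * e j) i) / k with hH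
  have hHd : Differentiable ℂ H := (Differentiable.fun_sum fun i _ =>
    (differentiable_expCoeff_mul e i).const_mul _).div_const _
  have h : (fun w : ℂ => expCoeff (fun j => w * e j) k) = fun w => w * H w := by
    ext w
    rw [hH, ← mul_div_assoc, eq_div_iff hk0, mul_comm, mul_expCoeff, mul_sum]
    exact sum_congr rfl fun i _ => by ring
  have h0 : H 0 = e k / k := by
    simp only [hH]
    rw [sum_eq_single 0]
    · rw [expCoeff_zero, Nat.sub_zero, mul_one]
    · intro i _ hi
      rw [expCoeff_zero_mul e (by omega), mul_zero]
    · intro h; exact absurd (mem_range.2 (by omega)) h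
  rw [h]
  rw [← h0]
  exact ((hasDerivAt_id' (0 : ℂ)).fun_mul (hHd 0).hasDerivAt).congr_deriv (by simp)

theorem hasDerivAt_expCoeff_add_mul (d : ℕ → ℝ) (e : ℕ → ℂ) (N : ℕ) :
    HasDerivAt (fun w : ℂ => expCoeff (fun j => (d j : ℂ) + w * e j) N)
      (∑ j ∈ Icc 1 N, e j / j * (pCoeff d (N - j) : ℂ)) 0 := by
  have h : (fun w : ℂ => expCoeff (fun j => (d j : ℂ) + w * e j) N)
      = fun w => ∑ i ∈ range N, (pCoeff d (N - (i + 1)) : ℂ) *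
          expCoeff (fun j => w * e j) (i + 1) + pCoeff d N := by
    ext w
    rw [expCoeff_add (fun j => (d j : ℂ)) (fun j => w * e j), ← sum_range_reflect,
      sum_range_succ']
    simp only [Nat.add_sub_cancel, Nat.sub_zero, Nat.sub_self, expCoeff_zero, mul_one,
      expCoeff_ofReal]
    congr 1
    refine sum_congr rfl fun i hi => ?_
    have := mem_range.1 hi
    rw [show N - (N - (i + 1)) = i + 1 by omega]
  rw [h, show Icc 1 N = Ico (0 + 1) (N + 1) by ext; simp,
    ← Finset.sum_Ico_add' (fun j => e j / (j : ℂ) * (pCoeff d (N - j) : ℂ)) 0 N 1, ← range_eq_Ico]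
  refine (HasDerivAt.fun_sum fun i _ => ?_).add_const _
  rw [mul_comm]
  exact (hasDerivAt_expCoeff_mul e (by omega)).const_mul _

theorem differentiable_expCoeff_add_mul (d : ℕ → ℝ) (e : ℕ → ℂ) (N : ℕ) :
    Differentiable ℂ fun w : ℂ => expCoeff (fun j => (d j : ℂ) + w * e j) N := by
  simp_rw [expCoeff_add]
  exact Differentiable.fun_sum fun i _ => (differentiable_expCoeff_mul e _).const_mul _

theorem IsLogSmall.mul {s ρ : ℝ} {g : ℕ → ℂ} (hg : IsLogSmall s ρ g) (w : ℂ) :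
    IsLogSmall s (‖w‖ * ρ) fun j => w * g j := by
  obtain ⟨t, h, hth, hsum⟩ := hg
  refine ⟨t, h, fun j hj => ⟨?_, (hth j hj).2⟩, hsum⟩
  rw [norm_mul, mul_assoc]
  exact mul_le_mul_of_nonneg_left (hth j hj).1 (norm_nonneg _)

theorem le_mul_sq_of_forall_le {x ρ δ : ℝ} (hδ : 0 < δ) (hρ : 0 ≤ ρ) (hρδ : ρ ≤ δ / 2)
    (hx : 0 ≤ x) (h : ∀ W : ℝ, 2 ≤ W → W * ρ ≤ δ → x ≤ 4 / W ^ 2) : x ≤ 4 / δ ^ 2 * ρ ^ 2 := by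
  rcases hρ.eq_or_lt with rfl | hpos
  · rcases hx.eq_or_lt with rfl | hx
    · positivity
    · have h4 : 0 < 4 / x := by positivity
      -- For `ρ = 0` every radius is admissible, and this one contradicts `0 < x`.
      have h1 := h (2 + 4 / x) (by linarith) (by rw [mul_zero]; exact hδ.le)
      rw [le_div_iff₀ (by positivity)] at h1
      have h2 : x * (4 / x) = 4 := by field_simp
      nlinarith
  · have h1 := h (δ / ρ) (by rw [le_div_iff₀ hpos]; linarith)
      (by rw [div_mul_cancel₀ _ hpos.ne'])
    refine h1.trans (le_of_eq ?_)
    field_simp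

/-- The first-order expansion, for perturbations controlled by `IsLogSmall`. -/
theorem exists_norm_remainder_le {a b s : ℝ} (ha : 0 < a) (ha1 : a ≤ 1) (hb : 1 ≤ b)
    (hs : 1 / a < s) :
    ∃ δ : ℝ, 0 < δ ∧ ∃ C : ℝ, 0 < C ∧ ∀ d : ℕ → ℝ, (∀ j, 1 ≤ j → a ≤ d j ∧ d j ≤ b) →
      ∀ (g : ℕ → ℂ) (N : ℕ), (∀ j, N < j → g j = 0) → ∀ ρ : ℝ, 0 ≤ ρ → ρ ≤ δ →
        IsLogSmall s ρ g →
        ‖expCoeff (fun j => (d j : ℂ) + (d j : ℂ) * g j) N / pCoeff d N *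
            Complex.exp (-∑ j ∈ Icc 1 N, (d j : ℂ) * g j / j)
          - 1 - ∑ j ∈ Icc 1 N, (d j : ℂ) * g j / j * ((pCoeff d (N - j) / pCoeff d N - 1 : ℝ) : ℂ)‖
        ≤ C * ρ ^ 2 := by
  obtain ⟨δ, hδ, key⟩ := exists_norm_expCoeff_le ha ha1 hb hs
  refine ⟨δ / 2, by positivity, 4 / δ ^ 2, by positivity, ?_⟩
  intro d hd g N hg ρ hρ hρδ hsmall
  set e : ℕ → ℂ := fun j => (d j : ℂ) * g j with he
  set L : ℂ := ∑ j ∈ Icc 1 N, e j / j with hL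
  have hp := pCoeff_pos ha hd N
  have hpc : (pCoeff d N : ℂ) ≠ 0 := by exact_mod_cast hp.ne'
  set A : ℂ → ℂ := fun w => expCoeff (fun j => (d j : ℂ) + w * e j) N with hA
  set Φ : ℂ → ℂ := fun w => A w / pCoeff d N * Complex.exp (-(w * L)) with hΦ
  have hAd : Differentiable ℂ A := differentiable_expCoeff_add_mul d e N
  have hΦd : Differentiable ℂ Φ :=
    (hAd.div_const _).mul ((differentiable_id.mul_const L).neg.cexp)
  have hA0 : A 0 = pCoeff d N := by
    simp only [hA, zero_mul, add_zero]
    exact expCoeff_ofReal d N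
  have hΦ0 : Φ 0 = 1 := by simp [hΦ, hA0, hpc]
  have hΦ1 : Φ 1 = expCoeff (fun j => (d j : ℂ) + (d j : ℂ) * g j) N / pCoeff d N *
      Complex.exp (-L) := by simp [hΦ, hA, he]
  have hderiv : deriv Φ 0
      = ∑ j ∈ Icc 1 N, e j / j * ((pCoeff d (N - j) / pCoeff d N - 1 : ℝ) : ℂ) := by
    have h1 : HasDerivAt A (∑ j ∈ Icc 1 N, e j / j * (pCoeff d (N - j) : ℂ)) 0 :=
      hasDerivAt_expCoeff_add_mul d e N
    have h2 : HasDerivAt (fun w : ℂ => Complex.exp (-(w * L))) (-L) 0 := by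
      have := (((hasDerivAt_id (0 : ℂ)).mul_const L).neg).cexp
      simpa using this
    have h3 := ((h1.div_const (pCoeff d N : ℂ)).mul h2).deriv
    have h4 : deriv Φ 0 = (∑ j ∈ Icc 1 N, e j / j * (pCoeff d (N - j) : ℂ)) / pCoeff d N - L := by
      refine Eq.trans h3 ?_
      rw [hA0, div_self hpc]
      simp [sub_eq_add_neg]
    rw [h4, hL, sum_div, ← sum_sub_distrib]
    refine sum_congr rfl fun j _ => ?_
    push_cast
    ring
  -- The uniform bound is applied to `z g`, whose size is `‖z‖ ρ ≤ δ`; its constant does not depend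
  -- on `z`.
  have hbound (W : ℝ) (hWρ : W * ρ ≤ δ) (z : ℂ) (hz : ‖z‖ ≤ W) : ‖Φ z‖ ≤ 2 := by
    have h1 := key d hd (fun j => z * g j) N (fun j hj => by simp [hg j hj]) (‖z‖ * ρ)
      (by positivity) ((mul_le_mul_of_nonneg_right hz hρ).trans hWρ) (hsmall.mul z) N
    have h2 : expSum (fun j => (d j : ℂ) * (z * g j)) N = Complex.exp (z * L) := by
      rw [expSum, hL, mul_sum]
      congr 1
      exact sum_congr rfl fun j _ => by simp only [he]; ring
    have h3 : expCoeff (fun j => (d j : ℂ) + (d j : ℂ) * (z * g j)) N = A z := by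
      simp only [hA, he]
      congr 1
      ext j
      ring
    rw [h2, h3] at h1
    have h4 : 0 < ‖Complex.exp (z * L)‖ := norm_pos_iff.2 (Complex.exp_ne_zero _)
    simp only [hΦ]
    rw [Complex.exp_neg, norm_mul, norm_div, norm_inv, Complex.norm_real,
      Real.norm_of_nonneg hp.le, ← div_eq_mul_inv, div_div, div_le_iff₀ (by positivity)]
    exact h1
  have hest (W : ℝ) (hW : 2 ≤ W) (hWρ : W * ρ ≤ δ) : ‖Φ 1 - Φ 0 - deriv Φ 0‖ ≤ 4 / W ^ 2 :=
    (norm_sub_sub_deriv_le hΦd hW (hbound W hWρ)).trans (le_of_eq (by ring))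
  have hfin := le_mul_sq_of_forall_le hδ hρ hρδ (norm_nonneg _) hest
  rw [hΦ0, hΦ1, hderiv] at hfin
  exact hfin

/-! ### From the size `ρ(p)` to logarithmic smallness. -/

theorem sum_norm_rpow_div_le_rho {f : ℕ → ℂ} {p : ℝ≥0∞} (hp : p ≠ ∞) (hs : 0 < p.toReal)
    (hf : rho f p ≠ ∞) (n : ℕ) :
    ∑ j ∈ Icc 1 n, ‖f j - 1‖ ^ p.toReal / j ≤ (rho f p).toReal ^ p.toReal := by
  set s := p.toReal
  have h1 : rho f p ^ s = ∑' j : ℕ, ‖f (j + 1) - 1‖ₑ ^ s / ((j + 1 : ℕ) : ℝ≥0∞) := by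
    rw [rho, if_neg hp, ← ENNReal.rpow_mul, one_div_mul_cancel hs.ne', ENNReal.rpow_one]
  have h2 : ENNReal.ofReal (∑ j ∈ Icc 1 n, ‖f j - 1‖ ^ s / j) ≤ rho f p ^ s := by
    rw [h1, ENNReal.ofReal_sum_of_nonneg fun j _ => by positivity]
    refine le_trans (le_of_eq ?_) (ENNReal.sum_le_tsum (range n))
    rw [show Icc 1 n = Ico (0 + 1) (n + 1) by ext; simp,
      ← Finset.sum_Ico_add' (fun j => ENNReal.ofReal (‖f j - 1‖ ^ s / (j : ℝ))) 0 n 1,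
      ← range_eq_Ico]
    refine sum_congr rfl fun j _ => ?_
    rw [ENNReal.ofReal_div_of_pos (by positivity), ← ENNReal.ofReal_rpow_of_nonneg (norm_nonneg _)
      hs.le, ofReal_norm, ENNReal.ofReal_natCast]
  have h3 : rho f p ^ s = ENNReal.ofReal ((rho f p).toReal ^ s) := by
    rw [← ENNReal.ofReal_rpow_of_nonneg ENNReal.toReal_nonneg hs.le, ENNReal.ofReal_toReal hf]
  rw [h3] at h2
  exact (ENNReal.ofReal_le_ofReal_iff (by positivity)).1 h2

theorem norm_le_rho_top {f : ℕ → ℂ} (hf : rho f ∞ ≠ ∞) {j : ℕ} (hj : 1 ≤ j) :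
    ‖f j - 1‖ ≤ (rho f ∞).toReal := by
  have h1 : ‖f j - 1‖ₑ ≤ rho f ∞ := by
    rw [rho, if_pos rfl]
    have := le_iSup (fun j : ℕ => ‖f (j + 1) - 1‖ₑ) (j - 1)
    simpa [Nat.sub_add_cancel hj] using this
  have := ENNReal.toReal_mono hf h1
  simpa using this

theorem isLogSmall_of_top {f : ℕ → ℂ} (hf : rho f ∞ ≠ ∞) {s : ℝ} (N : ℕ) :
    IsLogSmall s (rho f ∞).toReal fun j => if j ≤ N then f j - 1 else 0 := by
  refine ⟨fun _ => 1, fun _ => 0, fun j hj => ⟨?_, zero_le_one, by simp, le_rfl⟩, by simp⟩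
  change ‖if j ≤ N then f j - 1 else 0‖ ≤ (rho f ∞).toReal * 1
  split_ifs
  · rw [mul_one]; exact norm_le_rho_top hf hj
  · simp

theorem isLogSmall_of_ne_top {f : ℕ → ℂ} {p : ℝ≥0∞} (hp : p ≠ ∞) (hs : 0 < p.toReal)
    (hf : rho f p ≠ ∞) (N : ℕ) :
    IsLogSmall p.toReal (rho f p).toReal fun j => if j ≤ N then f j - 1 else 0 := by
  have h1 := sum_norm_rpow_div_le_rho hp hs hf
  set s := p.toReal
  set ρ := (rho f p).toReal with hρ
  have hρ0 : 0 ≤ ρ := ENNReal.toReal_nonneg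
  -- For `ρ = 0` the quotients are `0` by convention, which is harmless: the sum bound then forces
  -- `f j = 1`.
  refine ⟨fun j => ‖f j - 1‖ / ρ, fun j => (‖f j - 1‖ / ρ) ^ s,
    fun j hj => ⟨?_, by positivity, by linarith, by positivity⟩, fun n => ?_⟩
  · have h2 : ‖f j - 1‖ ≤ ρ * (‖f j - 1‖ / ρ) := by
      rcases hρ0.eq_or_lt with h0 | hpos
      · have h3 := (single_le_sum (f := fun j : ℕ => ‖f j - 1‖ ^ s / (j : ℝ))
          (fun k _ => by positivity) (mem_Icc.2 ⟨hj, le_rfl⟩)).trans (h1 j)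
        rw [← h0, Real.zero_rpow hs.ne'] at h3
        have hj0 : (0 : ℝ) < j := by exact_mod_cast hj
        rw [div_le_iff₀ hj0, zero_mul] at h3
        have h4 : ‖f j - 1‖ = 0 := by
          by_contra hne
          exact absurd h3 (not_le.2 (Real.rpow_pos_of_pos
            (lt_of_le_of_ne (norm_nonneg _) (Ne.symm hne)) s))
        rw [h4]; simp
      · rw [mul_div_cancel₀ _ hpos.ne']
    change ‖if j ≤ N then f j - 1 else 0‖ ≤ ρ * (‖f j - 1‖ / ρ)
    split_ifs
    · exact h2
    · rw [norm_zero]; positivity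
  · rcases hρ0.eq_or_lt with h0 | hpos
    · simp [← h0, Real.zero_rpow hs.ne']
    · have h2 : ∑ j ∈ Icc 1 n, (‖f j - 1‖ / ρ) ^ s / j
          = (∑ j ∈ Icc 1 n, ‖f j - 1‖ ^ s / j) / ρ ^ s := by
        rw [sum_div]
        refine sum_congr rfl fun j _ => ?_
        rw [Real.div_rpow (norm_nonneg _) hρ0]
        ring
      rw [h2, div_le_one (by positivity)]
      exact h1 n

end VoronoiMean

theorem theorem6 (dlo dhi : ℝ) (hdlo : 0 < dlo) (p : ℝ≥0∞)
    (hp : ENNReal.ofReal (max 1 (1 / dlo)) < p) :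
    ∃ δ : ℝ, 0 < δ ∧ ∃ C : ℝ, 0 < C ∧
      ∀ d : ℕ → ℝ, (∀ j : ℕ, 1 ≤ j → dlo ≤ d j ∧ d j ≤ dhi) →
        ∀ f : ℕ → ℂ, VoronoiMean.rho f p ≤ ENNReal.ofReal δ →
          ∀ N : ℕ, ∃ R : ℂ, ‖R‖ ≤ C * (VoronoiMean.rho f p).toReal ^ 2 ∧
            VoronoiMean.mCoeff d f N / (VoronoiMean.pCoeff d N : ℂ) =
              Complex.exp (VoronoiMean.lPoly d f N 1) *
                (1 + ∑ j ∈ Finset.Icc 1 N, (d j : ℂ) * ((f j - 1) / (j : ℂ)) *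
                    (((VoronoiMean.pCoeff d (N - j) / VoronoiMean.pCoeff d N - 1 : ℝ)) : ℂ)
                  + R) := by
  -- The growth estimates need `a ≤ 1 ≤ b`, so the bounds on `d` are relaxed to `min dlo 1` and `max
  -- dhi 1`. The condition on `p` already contains `max 1 (1 / dlo)`, so nothing is lost.
  set a := min dlo 1 with ha
  have ha0 : 0 < a := by positivity
  have ha1 : a ≤ 1 := min_le_right _ _
  have hinv : 1 / a ≤ max 1 (1 / dlo) := by
    rcases le_total dlo 1 with h | h
    · rw [ha, min_eq_left h]; exact le_max_right _ _
    · rw [ha, min_eq_right h, div_one]; exact le_max_left _ _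
  obtain ⟨s, hs, hsmall⟩ : ∃ s : ℝ, 1 / a < s ∧ ∀ f : ℕ → ℂ, VoronoiMean.rho f p ≠ ∞ →
      ∀ N : ℕ, VoronoiMean.IsLogSmall s (VoronoiMean.rho f p).toReal
        fun j => if j ≤ N then f j - 1 else 0 := by
    by_cases hpt : p = ∞
    · subst hpt
      -- For `p = ∞` any exponent above `1 / a` would do.
      refine ⟨2 / a, by gcongr; norm_num, fun f hf N => VoronoiMean.isLogSmall_of_top hf N⟩
    · have h1 := (ENNReal.ofReal_lt_iff_lt_toReal (le_max_of_le_left zero_le_one) hpt).1 hp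
      have h2 : 0 < p.toReal := lt_of_lt_of_le zero_lt_one ((le_max_left _ _).trans h1.le)
      exact ⟨p.toReal, hinv.trans_lt h1,
        fun f hf N => VoronoiMean.isLogSmall_of_ne_top hpt h2 hf N⟩
  obtain ⟨δ, hδ, C, hC, key⟩ := VoronoiMean.exists_norm_remainder_le ha0 ha1
    (le_max_right dhi 1) hs
  refine ⟨δ, hδ, C, hC, fun d hd f hf N => ?_⟩
  have hf' : VoronoiMean.rho f p ≠ ∞ := ne_top_of_le_ne_top ENNReal.ofReal_ne_top hf
  have hd' : ∀ j, 1 ≤ j → a ≤ d j ∧ d j ≤ max dhi 1 := fun j hj =>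
    ⟨(min_le_left _ _).trans (hd j hj).1, (hd j hj).2.trans (le_max_left _ _)⟩
  have h := key d hd' (fun j => if j ≤ N then f j - 1 else 0) N
    (fun j hj => if_neg (not_le.2 hj)) (VoronoiMean.rho f p).toReal ENNReal.toReal_nonneg
    (ENNReal.toReal_le_of_le_ofReal hδ.le hf) (hsmall f hf' N)
  refine ⟨_, h, ?_⟩
  have hm : VoronoiMean.expCoeff
      (fun j => (d j : ℂ) + (d j : ℂ) * if j ≤ N then f j - 1 else 0) N
      = VoronoiMean.mCoeff d f N :=
    VoronoiMean.expCoeff_congr fun j _ hj => by rw [if_pos hj]; ring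
  have hterm (j : ℕ) (hj : j ∈ Finset.Icc 1 N) : (d j : ℂ) * (if j ≤ N then f j - 1 else 0) / j
      = (d j : ℂ) * ((f j - 1) / (j : ℂ)) := by
    rw [if_pos (Finset.mem_Icc.1 hj).2, mul_div_assoc]
  have hl : ∑ j ∈ Finset.Icc 1 N, (d j : ℂ) * (if j ≤ N then f j - 1 else 0) / j
      = VoronoiMean.lPoly d f N 1 := by
    rw [VoronoiMean.lPoly]
    exact Finset.sum_congr rfl fun j hj => by rw [hterm j hj, one_pow, mul_one]
  have hs2 : ∑ j ∈ Finset.Icc 1 N, (d j : ℂ) * (if j ≤ N then f j - 1 else 0) / j *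
        ((VoronoiMean.pCoeff d (N - j) / VoronoiMean.pCoeff d N - 1 : ℝ) : ℂ)
      = ∑ j ∈ Finset.Icc 1 N, (d j : ℂ) * ((f j - 1) / (j : ℂ)) *
        ((VoronoiMean.pCoeff d (N - j) / VoronoiMean.pCoeff d N - 1 : ℝ) : ℂ) :=
    Finset.sum_congr rfl fun j hj => by rw [hterm j hj]
  rw [hm, hl, hs2, Complex.exp_neg]
  have := Complex.exp_ne_zero (VoronoiMean.lPoly d f N 1)
  field_simp
  ring
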